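/- Let $q\in\mathbb C$ with $0<|q|<1$, fix a fourth root $q^{1/4}$ and use its powers for the powers $q^{k/4}$, $k\in\mathbb Z$. Write $(z;q)_\infty=\prod_{j\ge 0}(1-zq^j)$ and $(z,w;q)_\infty=(z;q)_\infty(w;q)_\infty$. For $x,b\in\mathbb C^*$ put $y=-\frac12(q^{-1/4}x+q^{1/4}x^{-1})$ and define $p_k^{(b)}=p_k^{(b)}(y|q)$, $q_k^{(b)}=q_k^{(b)}(y|q)$ by $p_k^{(b)}=q_k^{(b)}=0$ for $k<0$ and, for $\lambda$ near $0$, $$\sum_{k\ge0}p_k^{(b)}\lambda^k=\frac{(q^{1/4}b\lambda,q^{3/4}b\lambda;q)_\infty}{(-q^{1/4}x\lambda,-q^{3/4}x^{-1}\lambda;q)_\infty},\qquad \sum_{k\ge0}q_k^{(b)}\lambda^k=\frac{(-q^{1/4}x\lambda,-q^{3/4}x^{-1}\lambda;q)_\infty}{(q^{1/4}b^{-1}\lambda,q^{3/4}b^{-1}\lambda;q)_\infty}.$$ For $m,n\ge0$ let $R_{m,n}^{(b)}(y)$ be the determinant of the $(m+n)\times(m+n)$ matrix with $(i,j)$ entry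 ($1\le i,j\le m+n$) equal to $q^{(b)}_{2i-j}$ if $i\le m$ and to $p^{(b)}_{m+n-2i+j+1}$ if $i>m$. Extend it to all $m,n\in\mathbb Z$ by $R_{m,n}^{(b)}=(-1)^{m(m+1)/2}R_{-m-1,n}^{(b)}$ for $m<0$ and $R_{m,n}^{(b)}=(-1)^{n(n+1)/2}R_{m,-n-1}^{(b)}$ for $n<0$. Set $$S_{m,n}(x,a)=R^{(b)}_{m,n}(y),\qquad b=q^{-(m-n)/2}a .$$ Theorem. Let $m,n\in\mathbb Z$ and $a\in\mathbb C^*$. For all $k,l\in\mathbb Z$ and $a'\in\mathbb C^*$ the function $S_{k,l}(\cdot,a')$ has only finitely many zeros in $\mathbb C^*$. There are rational functions $f_i(x)=f_i(x,a)$ of $x$, $i=0,1,2,3$, such that, at each $x\ne0$ where the denominators on the right are nonzero, $$\begin{aligned} 1+q^{\frac{2n-1}2}a f_0&=q^{\frac m2}(1+q^{-\frac{m-n+1}2}ax^{-1})\frac{S_{m,n}(x,a)S_{m-1,n-1}(q^{1/2}x,q^{-1}a)}{S_{m,n-1}(q^{1/2}x,a)S_{m-1,n}(x,q^{-1}a)},\\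 1+q^{-\frac{2n-1}2}a^{-1}f_0&=q^{-\frac n2}(1+q^{\frac{m-n+1}2}a^{-1}x^{-1})\frac{S_{m,n}(q^{1/2}x,a)S_{m-1,n-1}(x,q^{-1}a)}{S_{m,n-1}(q^{1/2}x,a)S_{m-1,n}(x,q^{-1}a)},\\ 1+a^{-1}f_1&=q^{\frac n2}(1+q^{\frac{m-n}2}a^{-1}x^{-1})\frac{S_{m-1,n}(x,q^{-1}a)S_{m,n-1}(q^{1/2}x,qa)}{S_{m,n}(q^{1/2}x,a)S_{m-1,n-1}(x,a)},\\ 1+af_1&=q^{\frac m2}(1+q^{-\frac{m-n}2}ax^{-1})\frac{S_{m-1,n}(q^{1/2}x,q^{-1}a)S_{m,n-1}(x,qa)}{S_{m,n}(q^{1/2}x,a)S_{m-1,n-1}(x,a)},\\ 1+q^{-\frac{2m+1}2}af_2&=q^{-\frac m2}(1+q^{-\frac{m-n+1}2}ax^{-1})\frac{S_{m-1,n-1}(x,a)S_{m,n}(q^{1/2}x,q^{-1}a)}{S_{m-1,n}(q^{1/2}x,q^{-1}a)S_{m,n-1}(x,a)},\\ 1+q^{\frac{2m+1}2}a^{-1}f_2&=q^{\frac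 n2}(1+q^{\frac{m-n+1}2}a^{-1}x^{-1})\frac{S_{m-1,n-1}(q^{1/2}x,a)S_{m,n}(x,q^{-1}a)}{S_{m-1,n}(q^{1/2}x,q^{-1}a)S_{m,n-1}(x,a)},\\ 1+q^{m-n}a^{-1}f_3&=q^{-\frac n2}(1+q^{\frac{m-n}2}a^{-1}x^{-1})\frac{S_{m,n-1}(x,a)S_{m-1,n}(q^{1/2}x,a)}{S_{m-1,n-1}(q^{1/2}x,a)S_{m,n}(x,a)},\\ 1+q^{-m+n}af_3&=q^{-\frac m2}(1+q^{-\frac{m-n}2}ax^{-1})\frac{S_{m,n-1}(q^{1/2}x,a)S_{m-1,n}(x,a)}{S_{m-1,n-1}(q^{1/2}x,a)S_{m,n}(x,a)}, \end{aligned}$$ and these $f_i$, with the parameters $(a_0,a_1,a_2,a_3)=(q^{n-\frac12}a,\,a^{-1},\,q^{-m-\frac12}a,\,q^{m-n}a^{-1})$, with $c=x^2$ and with the time evolution $\bar f_i(x)=f_i(q^{1/2}x)$ (so $\bar c=qc$ and $\bar a_i=a_i$), solve the symmetric $q$-Painlevé V system as rational functions of $x$: with indices modulo $4$ and $$D_i=1+a_if_i+a_ia_{i+1}f_if_{i+1}+a_ia_{i+1}a_{i+2}f_if_{i+1}f_{i+2},$$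 one has $D_i\ne0$ as a rational function, $$\bar f_i=a_ia_{i+1}f_{i+1}\frac{D_{i+2}}{D_i}\quad(i=0,1,2,3),\qquad a_0a_1a_2a_3=q^{-1},\qquad f_0f_2=f_1f_3=c^{-1}.$$ -/

import Mathlib

noncomputable section

namespace QPainleveV

/-- The infinite `q`-shifted factorial `(z; q)_∞ = ∏_{j ≥ 0} (1 - z q ^ j)`, for `‖q‖ < 1`. -/
def qPochInf (z q : ℂ) : ℂ := ∏' j : ℕ, (1 - z * q ^ j)

/-- The generating function of the `p_k`, as a function of the expansion variable `t`.
Throughout, `r` is the chosen fourth root `q ^ (1/4)`, so that `q = r ^ 4`. -/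
def pGen (r b x t : ℂ) : ℂ :=
  (qPochInf (r * b * t) (r ^ 4) * qPochInf (r ^ 3 * b * t) (r ^ 4)) /
    (qPochInf (-(r * x * t)) (r ^ 4) * qPochInf (-(r ^ 3 * x⁻¹ * t)) (r ^ 4))

/-- The generating function of the `q_k`, as a function of the expansion variable `t`. -/
def qGen (r b x t : ℂ) : ℂ :=
  (qPochInf (-(r * x * t)) (r ^ 4) * qPochInf (-(r ^ 3 * x⁻¹ * t)) (r ^ 4)) /
    (qPochInf (r * b⁻¹ * t) (r ^ 4) * qPochInf (r ^ 3 * b⁻¹ * t) (r ^ 4))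

/-- The coefficient of `t ^ k` in the Taylor expansion of `F` at `0`, extended by `0` to
negative `k`. -/
def taylorCoeff (F : ℂ → ℂ) : ℤ → ℂ
  | Int.ofNat k => iteratedDeriv k F 0 / (k.factorial : ℂ)
  | Int.negSucc _ => 0

/-- `p_k^{(b)}(y | q)` at `y = -(q ^ (-1/4) x + q ^ (1/4) x⁻¹) / 2`. -/
def pCoeff (r b x : ℂ) (k : ℤ) : ℂ := taylorCoeff (pGen r b x) k

/-- `q_k^{(b)}(y | q)` at `y = -(q ^ (-1/4) x + q ^ (1/4) x⁻¹) / 2`. -/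
def qCoeff (r b x : ℂ) (k : ℤ) : ℂ := taylorCoeff (qGen r b x) k

/-- The matrix of the determinant `R_{m,n}`, with rows and columns numbered from `0`: the first `m`
rows are `(q_{2i+1-j})_j`, the last `n` rows are `(p_{n+m-2i+j})_j`, so that row `m` starts with
`p_{n-m}` and the last row ends with `p_1`. -/
def RMatrix (r b x : ℂ) (m n : ℕ) : Matrix (Fin (m + n)) (Fin (m + n)) ℂ :=
  Matrix.of fun i j =>
    if (i : ℕ) < m then qCoeff r b x (2 * (i : ℤ) + 1 - (j : ℤ))
    else pCoeff r b x ((n : ℤ) + (m : ℤ) - 2 * (i : ℤ) + (j : ℤ))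

/-- The index `k` if `k ≥ 0` and `-k-1` if `k < 0`. -/
def reflIndex : ℤ → ℕ
  | Int.ofNat k => k
  | Int.negSucc k => k

/-- The sign `1` if `k ≥ 0` and `(-1) ^ (k (k+1) / 2)` if `k < 0`
(for `k = -l-1` one has `k (k+1) = l (l+1)`). -/
def reflSign : ℤ → ℂ
  | Int.ofNat _ => 1
  | Int.negSucc l => (-1) ^ (l * (l + 1) / 2)

/-- `R_{m,n}^{(b)}(y | q)` at `y = -(q ^ (-1/4) x + q ^ (1/4) x⁻¹) / 2`, for all integers `m, n`:
the determinant for `m, n ≥ 0`, extended by `R_{m,n} = (-1) ^ (m(m+1)/2) R_{-m-1,n}` and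
`R_{m,n} = (-1) ^ (n(n+1)/2) R_{m,-n-1}` to negative indices. -/
def R (r b x : ℂ) (m n : ℤ) : ℂ :=
  reflSign m * reflSign n * (RMatrix r b x (reflIndex m) (reflIndex n)).det

/-- `S_{m,n}(x, a) = R_{m,n}^{(b)}(y)` with `b = q ^ (-(m-n)/2) a`. -/
def S (r : ℂ) (m n : ℤ) (x a : ℂ) : ℂ := R r ((r ^ 2) ^ (-(m - n)) * a) x m n

/-- `1 + a_i f_i + a_i a_{i+1} f_i f_{i+1} + a_i a_{i+1} a_{i+2} f_i f_{i+1} f_{i+2}`, with indices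
modulo `4`. -/
def evolDen {K : Type*} [Field K] (a f : Fin 4 → K) (i : Fin 4) : K :=
  1 + a i * f i + a i * a (i + 1) * f i * f (i + 1)
    + a i * a (i + 1) * a (i + 2) * f i * f (i + 1) * f (i + 2)

/-- `(a_i; f_i)`, elements of a field `K` with time evolution `T : K → K`, solve the symmetric form
of the `q`-Painlevé V equation with independent variable `c`. Indices are modulo `4`. The
denominators of the system are required not to vanish. -/
structure IsSolution {K : Type*} [Field K] (T : K → K) (q c : K) (a f : Fin 4 → K) : Prop where
  evol_a : ∀ i, T (a i) = a i
  evol_c : T c = q * c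
  prod_a : a 0 * a 1 * a 2 * a 3 = q⁻¹
  norm_f02 : f 0 * f 2 = c⁻¹
  norm_f13 : f 1 * f 3 = c⁻¹
  den_ne_zero : ∀ i, evolDen a f i ≠ 0
  evol_f : ∀ i, T (f i) = a i * a (i + 1) * f (i + 1) * (evolDen a f (i + 2) / evolDen a f i)

/-- The substitution `x ↦ s x` in the rational functions of `x`. -/
def dilate (s : ℂ) (g : RatFunc ℂ) : RatFunc ℂ :=
  g.eval RatFunc.C (RatFunc.C s * RatFunc.X)

end QPainleveV

end

/-! The solution is a ratio of tau functions. With the four functions τ_i of `stairTau`, indices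
modulo 4, one takes f_i = x⁻¹ τ_{i+1}(q^{1/2}x) τ_{i+3}(x) / (τ_{i+3}(q^{1/2}x) τ_{i+1}(x)), which
is `stairRatio`. Then f_i f_{i+2} = x⁻² is automatic, and the remaining formulas reduce to bilinear
identities between the determinants R_{m,n}.

These identities come from one Plücker relation (`windowDet_plucker`). Over a common staircase of m
rows in q and n rows in p, two of four extra rows are placed: α^j, γ^j, a row u that turns m into m
± 1 and a row v that turns n into n ± 1. Column operations remove a geometric row α^j, at the price
of multiplying the generating function of p by 1 - αt and that of q by 1 - α⁻¹t. This gives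
`stairDet_bilinear`. For the infinite products at hand such multiplications are parameter shifts: α
= q^{-1/4}b sends b to q^{-1/2}b, while α = -q^{3/4}x⁻¹ and α = -q^{1/4}x send (b, x) to (q^{-1/2}b,
q^{∓1/2}x), up to a rescaling of t. The three pairs of nodes give `R_bilinear_up`, `R_bilinear_down`
and `R_bilinear_up_down`.

The first two are the eight formulas for 1 + a_i f_i and 1 + a_i⁻¹ f_i (`stairTau_up`,
`stairTau_down`). The third factors D_i = (1 + a_i f_i) + a_i a_{i+1} f_i f_{i+1} (1 + a_{i+2}
f_{i+2}) into tau functions (`evolDen_stairRatio`), and D_{i+2}/D_i then yields the evolution.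

Each R_{m,n} is a Laurent polynomial in x; its limit form for x → ∞ is a product of Vandermonde-type
determinants, hence nonzero (`exists_R_ne_zero`). Identities valid off a finite set pass to rational
functions by `Represents.ext`. -/

noncomputable section

namespace QPainleveV

/-! ### Determinants of functionals on a window of integers, and the Plücker relation -/

section Window

variable {K : Type*} [Field K]

/-- The determinant of the functionals `F 0, …, F (N - 1)` on the window `A, …, A + N - 1`. -/
def windowDet (A : ℤ) (N : ℕ) (F : ℕ → ℤ → K) : K :=
  (Matrix.of fun i j : Fin N => F i (A + (j : ℕ))).det

/-- Put the row `h` in front of the rows `F`. -/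
def consRow (h : ℤ → K) (F : ℕ → ℤ → K) : ℕ → ℤ → K
  | 0 => h
  | i + 1 => F i

/-- Insert the row `h` at position `k` into the rows `F`. -/
def insRow (k : ℕ) (h : ℤ → K) (F : ℕ → ℤ → K) : ℕ → ℤ → K := fun i =>
  if i < k then F i else if i = k then h else F (i - 1)

lemma windowDet_congr {A : ℤ} {N : ℕ} {F G : ℕ → ℤ → K}
    (h : ∀ i < N, ∀ j < N, F i (A + (j : ℕ)) = G i (A + (j : ℕ))) :
    windowDet A N F = windowDet A N G := by
  unfold windowDet
  congr 1
  ext i j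
  exact h i i.2 j j.2

lemma windowDet_consRow_expand (A : ℤ) (N : ℕ) (h : ℤ → K) (F : ℕ → ℤ → K) :
    windowDet A (N + 1) (consRow h F) = ∑ j : Fin (N + 1), (-1) ^ (j : ℕ) * h (A + (j : ℕ)) *
      (Matrix.of fun i k : Fin N => F i (A + ((j.succAbove k : Fin (N + 1)) : ℕ))).det := by
  unfold windowDet
  rw [Matrix.det_succ_row_zero]
  rfl

/-- Laplace expansion along the row h has the same minors wherever h stands; only the signs differ.
-/
lemma windowDet_insRow (A : ℤ) (N k : ℕ) (hk : k ≤ N) (h : ℤ → K) (F : ℕ → ℤ → K) :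
    windowDet A (N + 1) (insRow k h F) = (-1) ^ k * windowDet A (N + 1) (consRow h F) := by
  rw [windowDet_consRow_expand, Finset.mul_sum]
  unfold windowDet
  rw [Matrix.det_succ_row _ ⟨k, Nat.lt_succ_of_le hk⟩]
  refine Finset.sum_congr rfl fun j _ => ?_
  have : (Matrix.of fun i j : Fin (N + 1) => insRow k h F i (A + (j : ℕ))).submatrix
      (Fin.succAbove ⟨k, Nat.lt_succ_of_le hk⟩) j.succAbove =
      Matrix.of fun i l : Fin N => F i (A + ((j.succAbove l : Fin (N + 1)) : ℕ)) := by
    ext i l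
    simp only [Matrix.submatrix_apply, Matrix.of_apply, insRow]
    by_cases hi : (i : ℕ) < k
    · rw [Fin.succAbove_of_castSucc_lt _ _ (by simpa [Fin.lt_def] using hi)]
      simp [hi]
    · rw [Fin.succAbove_of_le_castSucc _ i (by simpa [Fin.le_def] using not_lt.1 hi)]
      have h1 : ¬ ((i : ℕ) + 1 < k) := by omega
      have h2 : (i : ℕ) + 1 ≠ k := by omega
      simp [h1, h2]
  rw [this]
  simp only [Matrix.of_apply, insRow, lt_irrefl, if_false, if_true]
  ring

omit [Field K] in
lemma consRow_insRow (k : ℕ) (a h : ℤ → K) (F : ℕ → ℤ → K) :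
    consRow a (insRow k h F) = insRow (k + 1) h (consRow a F) := by
  funext i
  cases i with
  | zero => simp [consRow, insRow]
  | succ i =>
    simp only [consRow, insRow, Nat.add_lt_add_iff_right, Nat.add_right_cancel_iff,
      Nat.add_sub_cancel]
    split_ifs with h1 h2
    · rfl
    · rfl
    · obtain ⟨i, rfl⟩ : ∃ l, i = l + 1 := ⟨i - 1, by omega⟩
      rfl

lemma windowDet_consRow_insRow (A : ℤ) (N k : ℕ) (hk : k ≤ N) (a h : ℤ → K)
    (F : ℕ → ℤ → K) :
    windowDet A (N + 2) (consRow a (consRow h F)) =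
      (-1) ^ k * windowDet A (N + 2) (consRow a (insRow k h F)) := by
  have h1 := windowDet_insRow A (N + 1) 1 (by omega) h (consRow a F)
  have h2 := windowDet_insRow A (N + 1) (k + 1) (by omega) h (consRow a F)
  rw [← consRow_insRow] at h1 h2
  have h3 : insRow 0 h F = consRow h F := by
    funext i
    cases i <;> simp [insRow, consRow]
  rw [h3] at h1
  rw [h1, h2, ← mul_assoc, ← pow_add]
  congr 1
  rw [show k + (k + 1) = 2 * k + 1 by ring, pow_succ _ (2 * k), pow_mul]
  simp

lemma windowDet_consRow_swap (A : ℤ) (N : ℕ) (a h : ℤ → K) (F : ℕ → ℤ → K) :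
    windowDet A (N + 2) (consRow a (consRow h F)) =
      - windowDet A (N + 2) (consRow h (consRow a F)) := by
  have h1 := windowDet_insRow A (N + 1) 1 (by omega) h (consRow a F)
  rw [← consRow_insRow] at h1
  have h3 : insRow 0 h F = consRow h F := by
    funext i
    cases i <;> simp [insRow, consRow]
  rw [h3] at h1
  rw [h1]
  ring

lemma windowDet_consRow_first (A : ℤ) (N : ℕ) (h : ℤ → K) (F : ℕ → ℤ → K)
    (h0 : ∀ j : ℕ, h (A + 1 + j) = 0) :
    windowDet A (N + 1) (consRow h F) = h A * windowDet (A + 1) N F := by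
  rw [windowDet_consRow_expand, Fin.sum_univ_succ, Finset.sum_eq_zero]
  · simp only [Fin.val_zero, pow_zero, one_mul, Nat.cast_zero, add_zero, windowDet]
    congr 2
    ext i j
    simp only [Fin.succAbove_zero, Matrix.of_apply, Fin.val_succ, Nat.cast_add, Nat.cast_one]
    congr 1
    ring
  · intro j _
    have := h0 j
    rw [show A + ((j.succ : Fin (N + 1)) : ℕ) = A + 1 + (j : ℕ) by push_cast [Fin.val_succ]; ring,
      this]
    simp

lemma windowDet_last (A : ℤ) (N : ℕ) (F : ℕ → ℤ → K) (h0 : ∀ j < N, F N (A + (j : ℕ)) = 0) :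
    windowDet A (N + 1) F = F N (A + N) * windowDet A N F := by
  unfold windowDet
  rw [Matrix.det_succ_row _ (Fin.last N), Fin.sum_univ_castSucc, Finset.sum_eq_zero]
  · simp only [Fin.val_last, ← two_mul, pow_mul, Matrix.of_apply]
    simp only [even_two, Even.neg_pow, one_pow, one_mul, zero_add]
    congr 2
    ext i j
    simp
  · intro j _
    simp [h0 j j.2]

lemma windowDet_consRow_last (A : ℤ) (N : ℕ) (h : ℤ → K) (F : ℕ → ℤ → K)
    (h0 : ∀ j < N, h (A + (j : ℕ)) = 0) :
    windowDet A (N + 1) (consRow h F) = (-1) ^ N * (h (A + N) * windowDet A N F) := by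
  have h1 := windowDet_insRow A N N le_rfl h F
  rw [windowDet_last A N (insRow N h F) (by simpa [insRow] using h0)] at h1
  have h2 : windowDet A N (insRow N h F) = windowDet A N F :=
    windowDet_congr fun i hi j _ => by simp [insRow, hi]
  rw [h2] at h1
  have h3 : insRow N h F N (A + N) = h (A + N) := by simp [insRow]
  rw [h3] at h1
  rw [h1, ← mul_assoc, ← mul_pow]
  simp

/-- Multiplication of the argument of every functional by `z - α`. -/
def mulRow (α : K) (F : ℕ → ℤ → K) : ℕ → ℤ → K := fun i j => F i (j + 1) - α * F i j

/-- Subtracting α times the preceding column from every column after the first clears the geometric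
row except for its first entry α^A. -/
lemma windowDet_consRow_zpow (A : ℤ) (N : ℕ) (α : K) (hα : α ≠ 0) (F : ℕ → ℤ → K) :
    windowDet A (N + 1) (consRow (fun j => α ^ j) F) = α ^ A * windowDet A N (mulRow α F) := by
  set M : Matrix (Fin (N + 1)) (Fin (N + 1)) K :=
    Matrix.of fun i j => consRow (fun j => α ^ j) F i (A + (j : ℕ)) with hM
  set B : Matrix (Fin (N + 1)) (Fin (N + 1)) K :=
    Matrix.of fun i j => Fin.cases (M i 0) (fun l => M i l.succ - α * M i l.castSucc) j with hB
  have h1 : M.det = B.det := by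
    refine Matrix.det_eq_of_forall_col_eq_smul_add_pred (fun _ => α) (fun i => ?_) (fun i j => ?_)
    · simp [hB]
    · simp [hB]
  have h2 : windowDet A (N + 1) (consRow (fun j => α ^ j) F) = M.det := rfl
  rw [h2, h1, Matrix.det_succ_row_zero, Fin.sum_univ_succ, Finset.sum_eq_zero]
  · simp only [Fin.val_zero, pow_zero, one_mul, add_zero]
    congr 1
    · simp [hB, hM, consRow]
    · unfold windowDet
      congr 1
      ext i j
      simp [hB, hM, consRow, mulRow, add_assoc]
  · intro j _
    have : B 0 j.succ = 0 := by
      simp only [hB, hM, Matrix.of_apply, Fin.cases_succ, Fin.val_zero, consRow, Fin.val_succ,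
        Fin.val_castSucc, Nat.cast_add, Nat.cast_one]
      rw [← add_assoc, zpow_add_one₀ hα]
      ring
    rw [this]
    simp

lemma windowDet_add (A c : ℤ) (N : ℕ) (F : ℕ → ℤ → K) :
    windowDet (A + c) N F = windowDet A N (fun i j => F i (j + c)) := by
  unfold windowDet
  congr 1
  ext i j
  simp only [Matrix.of_apply]
  congr 1
  ring

lemma windowDet_mul (A : ℤ) (N : ℕ) (c : ℕ → K) (F : ℕ → ℤ → K) :
    windowDet A N (fun i j => c i * F i j) = (∏ i : Fin N, c i) * windowDet A N F := by
  unfold windowDet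
  exact Matrix.det_mul_column (fun i : Fin N => c i) _

lemma windowDet_mul_lt (A : ℤ) (m n : ℕ) (c : K) (F : ℕ → ℤ → K) :
    windowDet A (m + n) (fun i j => (if i < m then c else 1) * F i j) =
      c ^ m * windowDet A (m + n) F := by
  rw [windowDet_mul A (m + n) (fun i => if i < m then c else 1), Fin.prod_univ_add]
  simp

/-- The three-term Plücker relation. -/
lemma windowDet_plucker (A : ℤ) (N : ℕ) (a b c d : ℤ → K) (F : ℕ → ℤ → K) :
    windowDet A (N + 2) (consRow a (consRow b F)) * windowDet A (N + 2) (consRow c (consRow d F)) =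
      windowDet A (N + 2) (consRow a (consRow c F)) *
        windowDet A (N + 2) (consRow b (consRow d F)) -
      windowDet A (N + 2) (consRow b (consRow c F)) *
        windowDet A (N + 2) (consRow a (consRow d F)) := by
  set M : Matrix (Fin (N + 2)) (Fin (N + 2)) K :=
    Matrix.of fun i j => consRow a (consRow b F) i (A + (j : ℕ)) with hM
  set v : Fin (N + 2) → K := fun j => c (A + (j : ℕ)) with hv
  -- Cramer's rule: det M times the row v is a combination of the rows of M, with coefficients the
  -- determinants of M with one row replaced by v.
  have cram : ∀ j, ∑ i, M i j * (M.updateRow i v).det = M.det * v j := by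
    intro j
    have := congrFun (Matrix.mulVec_cramer M.transpose v) j
    simpa [Matrix.mulVec, dotProduct, Matrix.cramer_transpose_apply, Matrix.det_transpose]
      using this
  set C : Fin (N + 2) → K := fun j => (-1) ^ (j : ℕ) *
    (Matrix.of fun i k : Fin (N + 1) =>
      consRow d F i (A + ((j.succAbove k : Fin (N + 2)) : ℕ))).det with hC
  have expand : ∀ w : ℤ → K, windowDet A (N + 2) (consRow w (consRow d F)) =
      ∑ j, w (A + ((j : Fin (N + 2)) : ℕ)) * C j := by
    intro w
    rw [windowDet_consRow_expand]
    refine Finset.sum_congr rfl fun j _ => ?_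
    simp only [hC]
    ring
  -- Cramer's rule is inserted into the row c of the second determinant, which is linear in that
  -- row.
  have key : M.det * windowDet A (N + 2) (consRow c (consRow d F)) =
      ∑ i : Fin (N + 2), (M.updateRow i v).det *
        windowDet A (N + 2) (consRow (consRow a (consRow b F) i) (consRow d F)) := by
    rw [expand c, Finset.mul_sum]
    simp_rw [expand, Finset.mul_sum]
    rw [Finset.sum_comm]
    refine Finset.sum_congr rfl fun j _ => ?_
    rw [← mul_assoc, ← cram j, Finset.sum_mul]
    refine Finset.sum_congr rfl fun i _ => ?_
    simp only [hM, Matrix.of_apply]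
    ring
  have h0 : (M.updateRow 0 v).det = windowDet A (N + 2) (consRow c (consRow b F)) := by
    unfold windowDet
    congr 1
    ext i j
    refine Fin.cases ?_ (fun i => ?_) i
    · simp [hv, consRow]
    · simp [hM, consRow]
  have h1 : (M.updateRow 1 v).det = windowDet A (N + 2) (consRow a (consRow c F)) := by
    unfold windowDet
    congr 1
    ext i j
    refine Fin.cases ?_ (fun i => Fin.cases ?_ (fun i => ?_) i) i
    · rw [Matrix.updateRow_ne (by simp)]
      simp [hM, consRow]
    · rw [show Fin.succ (0 : Fin (N + 1)) = 1 from rfl, Matrix.updateRow_self]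
      simp [hv, consRow]
    · rw [Matrix.updateRow_ne (by simp [Fin.ext_iff])]
      simp [hM, consRow]
  -- Only the rows a and b survive: a row taken from F occurs twice.
  have h2 : ∀ i : Fin N, windowDet A (N + 2) (consRow (consRow a (consRow b F)
      (i.succ.succ : Fin (N + 2))) (consRow d F)) = 0 := by
    intro i
    unfold windowDet
    refine Matrix.det_zero_of_row_eq (i := 0) (j := i.succ.succ) (by simp [Fin.ext_iff]) ?_
    ext j
    simp [consRow]
  have hab : windowDet A (N + 2) (consRow a (consRow b F)) = M.det := rfl
  rw [hab, key, Fin.sum_univ_succ, Fin.sum_univ_succ, Finset.sum_eq_zero]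
  · rw [h0, Fin.succ_zero_eq_one, h1, windowDet_consRow_swap A N c b]
    simp only [Fin.val_zero, consRow, Fin.val_one]
    ring
  · intro i _
    rw [h2, mul_zero]

end Window

/-! ### Staircase determinants and their bilinear relation -/

section Staircase

variable {K : Type*} [Field K]

/-- The rows of a staircase determinant: `m` rows made of `q`, then rows made of `p`. -/
def stairRow (p q : ℤ → K) (m : ℕ) (c : ℤ) : ℕ → ℤ → K := fun i j =>
  if i < m then q (2 * i + 1 - j) else p (c - 2 * (i - m) + j)

/-- The staircase determinant built from the sequences `p` and `q`. -/
def stairDet (p q : ℤ → K) (m n : ℕ) : K :=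
  windowDet 0 (m + n) (stairRow p q m (n - m))

/-- The effect of multiplying the generating function by `1 - α t` on the coefficients. -/
def backShift (α : K) (p : ℤ → K) : ℤ → K := fun k => p k - α * p (k - 1)

/-- The value `1` at `0`, and `0` at negative integers. -/
structure IsUnital (p : ℤ → K) : Prop where
  zero : p 0 = 1
  neg : ∀ k < 0, p k = 0

lemma IsUnital.backShift {p : ℤ → K} (hp : IsUnital p) (α : K) : IsUnital (backShift α p) where
  zero := by simp [QPainleveV.backShift, hp.zero, hp.neg (-1) (by norm_num)]
  neg k hk := by simp [QPainleveV.backShift, hp.neg k hk, hp.neg (k - 1) (by omega)]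

/-- The column index enters p with sign + and q with sign -, so the same operation z - α acts
through the node α on p and through α⁻¹ on q, where a factor -α splits off. -/
lemma mulRow_stairRow (p q : ℤ → K) (m : ℕ) (c : ℤ) (α : K) (hα : α ≠ 0) :
    mulRow α (stairRow p q m c) = fun i j => (if i < m then -α else 1) *
      stairRow (backShift α p) (backShift α⁻¹ q) m (c + 1) i j := by
  funext i j
  simp only [mulRow, stairRow, backShift]
  split_ifs with h
  · rw [show 2 * (i : ℤ) + 1 - (j + 1) = 2 * i + 1 - j - 1 by ring]
    field_simp
    ring
  · rw [show c - 2 * ((i : ℤ) - m) + (j + 1) = c + 1 - 2 * (i - m) + j by ring,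
      show c - 2 * ((i : ℤ) - m) + j = c + 1 - 2 * (i - m) + j - 1 by ring]
    ring

lemma windowDet_zpow_stairRow (A : ℤ) (m n : ℕ) (p q : ℤ → K) (c : ℤ) (α : K) (hα : α ≠ 0) :
    windowDet A (m + n + 1) (consRow (fun j => α ^ j) (stairRow p q m c)) =
      α ^ A * ((-α) ^ m *
        windowDet A (m + n) (stairRow (backShift α p) (backShift α⁻¹ q) m (c + 1))) := by
  rw [windowDet_consRow_zpow _ _ _ hα, mulRow_stairRow _ _ _ _ _ hα, windowDet_mul_lt]

lemma mulRow_mul (α : K) (c : ℕ → K) (F : ℕ → ℤ → K) :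
    mulRow α (fun i j => c i * F i j) = fun i j => c i * mulRow α F i j := by
  funext i j
  simp only [mulRow]
  ring

lemma windowDet_zpow_zpow (m n : ℕ) (p q : ℤ → K) (c : ℤ) (α γ : K) (hα : α ≠ 0)
    (hγ : γ ≠ 0) :
    windowDet 0 (m + n + 2)
      (consRow (fun j => α ^ j) (consRow (fun j => γ ^ j) (stairRow p q m c))) =
      (γ - α) * (α * γ) ^ m *
        windowDet 0 (m + n) (stairRow (backShift γ (backShift α p))
          (backShift γ⁻¹ (backShift α⁻¹ q)) m (c + 2)) := by
  rw [windowDet_consRow_zpow _ _ _ hα]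
  -- Multiplication by z - α keeps the row γ^j geometric and scales it by γ - α, the source of that
  -- factor in the bilinear relation.
  have h1 : mulRow α (consRow (fun j => γ ^ j) (stairRow p q m c)) =
      fun i j => (if i < 1 then γ - α else 1) *
        consRow (fun j => γ ^ j) (mulRow α (stairRow p q m c)) i j := by
    funext i j
    cases i with
    | zero =>
      simp only [mulRow, consRow, zpow_add_one₀ hγ, Nat.lt_one_iff, if_true]
      ring
    | succ i => simp [mulRow, consRow]
  rw [h1, show m + n + 1 = 1 + (m + n) by ring, windowDet_mul_lt, add_comm 1 (m + n),
    windowDet_consRow_zpow _ _ _ hγ, mulRow_stairRow _ _ _ _ _ hα,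
    mulRow_mul γ (fun i => if i < m then -α else 1), windowDet_mul_lt,
    mulRow_stairRow _ _ _ _ _ hγ, windowDet_mul_lt]
  rw [show α * γ = (-α) * (-γ) by ring, mul_pow, add_assoc c 1 1]
  norm_num
  ring

omit [Field K] in
lemma insRow_stairRow_left (p q : ℤ → K) (m : ℕ) (c : ℤ) :
    insRow m (fun j => q (2 * m + 1 - j)) (stairRow p q m c) = stairRow p q (m + 1) c := by
  funext i j
  rw [insRow, stairRow]
  rcases lt_trichotomy i m with h | h | h
  · simp [stairRow, h, Nat.lt_succ_of_lt h]
  · simp [h]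
  · obtain ⟨i, rfl⟩ : ∃ l, i = l + 1 := ⟨i - 1, by omega⟩
    rw [if_neg (by omega), if_neg (by omega), if_neg (by omega), Nat.add_sub_cancel, stairRow,
      if_neg (by omega)]
    congr 1
    push_cast
    ring

omit [Field K] in
lemma insRow_stairRow_right (p q : ℤ → K) (m : ℕ) (c : ℤ) :
    insRow m (fun j => p (c + 2 + j)) (stairRow p q m c) = stairRow p q m (c + 2) := by
  funext i j
  rw [insRow, stairRow]
  rcases lt_trichotomy i m with h | h | h
  · simp [stairRow, h]
  · simp [h]
  · obtain ⟨i, rfl⟩ : ∃ l, i = l + 1 := ⟨i - 1, by omega⟩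
    rw [if_neg (by omega), if_neg (by omega), if_neg (by omega), Nat.add_sub_cancel, stairRow,
      if_neg (by omega)]
    congr 1
    push_cast
    ring

/-- With this offset the last row in p is the last unit vector, so it can be deleted with the last
column. For n = 0 there is nothing to delete, in agreement with the truncated n - 1 = 0. -/
lemma windowDet_stairRow_last {p : ℤ → K} (hp : IsUnital p) (q : ℤ → K) (A : ℤ) (m n : ℕ) :
    windowDet A (m + n) (stairRow p q m (n - m - 1 - A)) =
      windowDet A (m + (n - 1)) (stairRow p q m (n - m - 1 - A)) := by
  cases n with
  | zero => rfl
  | succ n =>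
    have hrow : ∀ j : ℤ, stairRow p q m ((n + 1 : ℕ) - m - 1 - A) (m + n) (A + j) =
        p (j - (m + n)) := by
      intro j
      simp only [stairRow]
      rw [if_neg (by omega)]
      congr 1
      push_cast
      ring
    rw [← add_assoc, windowDet_last, hrow]
    · push_cast
      rw [sub_self, hp.zero, one_mul]
    · intro j hj
      rw [hrow]
      exact hp.neg _ (by omega)

/-- On the window starting at 1 the first row in q is the first unit vector; deleting it leaves a
staircase with m - 1 rows in q. For m = 0 the shift of the window absorbs the -1 in the offset, in
agreement with the truncated m - 1 = 0. -/
lemma windowDet_one_stairRow (p : ℤ → K) {q : ℤ → K} (hq : IsUnital q) (m n : ℕ) :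
    windowDet 1 (m + n) (stairRow p q m (n - m - 1)) =
      windowDet 0 (m - 1 + n) (stairRow p q (m - 1) (n - (m - 1 : ℕ))) := by
  cases m with
  | zero =>
    rw [show (1 : ℤ) = 0 + 1 by ring, windowDet_add]
    simp only [Nat.zero_sub]
    congr 1
    funext i j
    simp only [stairRow, Nat.not_lt_zero, if_false]
    congr 1
    ring
  | succ m =>
    have h1 : stairRow p q (m + 1) (n - (m + 1 : ℕ) - 1) =
        consRow (fun j => q (1 - j)) (fun i j => stairRow p q m (n - m) i (j - 2)) := by
      funext i j
      cases i with
      | zero => simp [stairRow, consRow]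
      | succ i =>
        simp only [stairRow, consRow, Nat.add_lt_add_iff_right]
        split_ifs
        · congr 1
          push_cast
          ring
        · congr 1
          push_cast
          ring
    rw [h1, show m + 1 + n = m + n + 1 by ring, windowDet_consRow_first]
    · rw [sub_self, hq.zero, one_mul, show (1 : ℤ) + 1 = 0 + 2 by ring, windowDet_add]
      simp
    · intro j
      exact hq.neg _ (by omega)

lemma windowDet_one_stairRow_last {p q : ℤ → K} (hp : IsUnital p) (hq : IsUnital q) (m n : ℕ) :
    windowDet 1 (m + n) (stairRow p q m (n - m - 2)) =
      windowDet 0 (m - 1 + (n - 1)) (stairRow p q (m - 1) ((n - 1 : ℕ) - (m - 1 : ℕ))) := by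
  have h := windowDet_stairRow_last hp q 1 m n
  rw [show (n : ℤ) - m - 1 - 1 = n - m - 2 by ring] at h
  rw [h, ← windowDet_one_stairRow p hq]
  refine windowDet_congr fun i hi j _ => ?_
  cases n with
  | zero =>
    have : i < m := by omega
    simp [stairRow, this]
  | succ n =>
    congr 1
    simp only [Nat.add_sub_cancel]
    push_cast
    ring

/-- This lemma and those up to `windowDet_low_far` evaluate the minors of the Plücker relation. The
row `q (2 * m + 1 - j)` continues the staircase in q (m becomes m + 1) and `p (n - m - 2 + 2 + j)`
the one in p (n becomes n + 1). The rows `q (0 - j)` and `p (j - (m + n + 1))` are the first and the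
last unit vector, which shorten the two parts. The offset n - m - 2 is the one that two geometric
rows raise to n - m. -/
lemma windowDet_zpow_top (p q : ℤ → K) {δ : K} (hδ : δ ≠ 0) (m n : ℕ) :
    windowDet 0 (m + n + 2) (consRow (fun j => δ ^ j)
      (consRow (fun j => q (2 * m + 1 - j)) (stairRow p q m (n - m - 2)))) =
      -1 * (δ ^ (m + 1) * stairDet (backShift δ p) (backShift δ⁻¹ q) (m + 1) n) := by
  rw [windowDet_consRow_insRow _ _ m (by omega), insRow_stairRow_left,
    show m + n + 2 = m + 1 + n + 1 by ring, windowDet_zpow_stairRow _ _ _ _ _ _ _ hδ, stairDet,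
    show (n : ℤ) - m - 2 + 1 = n - (m + 1 : ℕ) by push_cast; ring, zpow_zero, one_mul, ← mul_assoc,
    ← mul_assoc, neg_pow δ, ← mul_assoc, ← pow_add, show m + (m + 1) = 2 * m + 1 by ring,
    pow_succ _ (2 * m), pow_mul]
  simp

lemma windowDet_zpow_right (p q : ℤ → K) {δ : K} (hδ : δ ≠ 0) (m n : ℕ) :
    windowDet 0 (m + n + 2) (consRow (fun j => δ ^ j)
      (consRow (fun j => p (n - m - 2 + 2 + j)) (stairRow p q m (n - m - 2)))) =
      1 * (δ ^ m * stairDet (backShift δ p) (backShift δ⁻¹ q) m (n + 1)) := by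
  rw [windowDet_consRow_insRow _ _ m (by omega), insRow_stairRow_right,
    show m + n + 2 = m + (n + 1) + 1 by ring, windowDet_zpow_stairRow _ _ _ _ _ _ _ hδ, stairDet,
    show (n : ℤ) - m - 2 + 2 + 1 = (n + 1 : ℕ) - m by push_cast; ring, zpow_zero, one_mul,
    ← mul_assoc, ← mul_pow, neg_one_mul, neg_neg, one_mul]

lemma windowDet_top_right (p q : ℤ → K) (m n : ℕ) :
    windowDet 0 (m + n + 2) (consRow (fun j => q (2 * m + 1 - j))
      (consRow (fun j => p (n - m - 2 + 2 + j)) (stairRow p q m (n - m - 2)))) =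
      stairDet p q (m + 1) (n + 1) := by
  have h := windowDet_insRow 0 (m + n + 1) m (by omega) (fun j => q (2 * m + 1 - j))
    (stairRow p q m (n - m - 2 + 2))
  rw [windowDet_consRow_insRow _ _ m (by omega), insRow_stairRow_right, ← h,
    insRow_stairRow_left, stairDet, show m + n + 1 + 1 = m + 1 + (n + 1) by ring]
  congr 2
  push_cast
  ring

lemma windowDet_zpow_low (p : ℤ → K) {q : ℤ → K} (hq : IsUnital q) {δ : K} (hδ : δ ≠ 0)
    (m n : ℕ) :
    windowDet 0 (m + n + 2) (consRow (fun j => δ ^ j)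
      (consRow (fun j => q (0 - j)) (stairRow p q m (n - m - 2)))) =
      -(-1) ^ m * (δ ^ (m + 1) * stairDet (backShift δ p) (backShift δ⁻¹ q) (m - 1) n) := by
  rw [windowDet_consRow_swap, windowDet_consRow_first, sub_self, hq.zero, one_mul, zero_add,
    windowDet_zpow_stairRow _ _ _ _ _ _ _ hδ, show (n : ℤ) - m - 2 + 1 = n - m - 1 by ring,
    windowDet_one_stairRow _ (hq.backShift _), stairDet, neg_pow δ, zpow_one]
  · ring
  · intro j
    exact hq.neg _ (by omega)

lemma windowDet_zpow_far {p : ℤ → K} (hp : IsUnital p) (q : ℤ → K) {δ : K} (hδ : δ ≠ 0)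
    (m n : ℕ) :
    windowDet 0 (m + n + 2) (consRow (fun j => δ ^ j)
      (consRow (fun j => p (j - (m + n + 1))) (stairRow p q m (n - m - 2)))) =
      (-1) ^ n * (δ ^ m * stairDet (backShift δ p) (backShift δ⁻¹ q) m (n - 1)) := by
  rw [windowDet_consRow_swap, windowDet_consRow_last, windowDet_zpow_stairRow _ _ _ _ _ _ _ hδ]
  · push_cast
    rw [zero_add, sub_self, hp.zero, show (n : ℤ) - m - 2 + 1 = n - m - 1 - 0 by ring,
      windowDet_stairRow_last (hp.backShift _), stairDet, neg_pow δ, zpow_zero]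
    have h : windowDet 0 (m + (n - 1)) (stairRow (backShift δ p) (backShift δ⁻¹ q) m
        (n - m - 1 - 0)) = windowDet 0 (m + (n - 1)) (stairRow (backShift δ p) (backShift δ⁻¹ q) m
        ((n - 1 : ℕ) - m)) := by
      refine windowDet_congr fun i hi j _ => ?_
      cases n with
      | zero =>
        have : i < m := by omega
        simp [stairRow, this]
      | succ n =>
        congr 1
        simp only [Nat.add_sub_cancel]
        push_cast
        ring
    rw [h, pow_succ, pow_add]
    have : ((-1 : K) ^ m) * (-1) ^ m = 1 := by rw [← mul_pow]; simp
    linear_combination ((-1) ^ n * δ ^ m * windowDet 0 (m + (n - 1)) (stairRow (backShift δ p)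
      (backShift δ⁻¹ q) m ((n - 1 : ℕ) - m))) * this
  · intro j hj
    exact hp.neg _ (by omega)

lemma windowDet_low_right (p : ℤ → K) {q : ℤ → K} (hq : IsUnital q) (m n : ℕ) :
    windowDet 0 (m + n + 2) (consRow (fun j => q (0 - j))
      (consRow (fun j => p (n - m - 2 + 2 + j)) (stairRow p q m (n - m - 2)))) =
      (-1) ^ m * stairDet p q (m - 1) (n + 1) := by
  rw [windowDet_consRow_insRow _ _ m (by omega), insRow_stairRow_right, windowDet_consRow_first,
    sub_self, hq.zero, one_mul, zero_add, show m + n + 1 = m + (n + 1) by ring,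
    show (n : ℤ) - m - 2 + 2 = (n + 1 : ℕ) - m - 1 by push_cast; ring,
    windowDet_one_stairRow _ hq, stairDet]
  intro j
  exact hq.neg _ (by omega)

lemma windowDet_top_far {p : ℤ → K} (hp : IsUnital p) (q : ℤ → K) (m n : ℕ) :
    windowDet 0 (m + n + 2) (consRow (fun j => q (2 * m + 1 - j))
      (consRow (fun j => p (j - (m + n + 1))) (stairRow p q m (n - m - 2)))) =
      (-1) ^ n * stairDet p q (m + 1) (n - 1) := by
  have h := windowDet_insRow 0 (m + n) m (by omega) (fun j => q (2 * m + 1 - j))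
    (stairRow p q m (n - m - 2))
  rw [insRow_stairRow_left, show (n : ℤ) - m - 2 = n - (m + 1 : ℕ) - 1 - 0 by push_cast; ring,
    show m + n + 1 = m + 1 + n by ring, windowDet_stairRow_last hp] at h
  rw [windowDet_consRow_swap, windowDet_consRow_last]
  · have h' : windowDet 0 (m + 1 + (n - 1)) (stairRow p q (m + 1) (n - (m + 1 : ℕ) - 1 - 0)) =
        stairDet p q (m + 1) (n - 1) := by
      refine windowDet_congr fun i hi j _ => ?_
      cases n with
      | zero =>
        have : i < m + 1 := by omega
        simp [stairRow, this]
      | succ n =>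
        congr 1
        simp only [Nat.add_sub_cancel]
        push_cast
        ring
    rw [← h', h, show (n : ℤ) - m - 2 = n - (m + 1 : ℕ) - 1 - 0 by push_cast; ring]
    push_cast
    rw [zero_add, sub_self, hp.zero, pow_succ, pow_add, add_right_comm m n 1]
    ring
  · intro j hj
    exact hp.neg _ (by omega)

lemma windowDet_low_far {p q : ℤ → K} (hp : IsUnital p) (hq : IsUnital q) (m n : ℕ) :
    windowDet 0 (m + n + 2) (consRow (fun j => q (0 - j))
      (consRow (fun j => p (j - (m + n + 1))) (stairRow p q m (n - m - 2)))) =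
      (-1) ^ m * (-1) ^ n * stairDet p q (m - 1) (n - 1) := by
  rw [windowDet_consRow_first, windowDet_consRow_last, sub_self, hq.zero, zero_add,
    windowDet_one_stairRow_last hp hq, stairDet]
  · push_cast
    rw [show (1 : ℤ) + (m + n) - (m + n + 1) = 0 by ring, hp.zero, pow_add]
    ring
  · intro j hj
    exact hp.neg _ (by omega)
  · intro j
    exact hq.neg _ (by omega)

/-- The left and right neighbours of a natural number, where the left neighbour of `0` is `0`. -/
def IsNext (m m' : ℕ) : Prop := m' = m + 1 ∨ m' = m - 1

/-- The bilinear relation for staircase determinants. -/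
lemma stairDet_bilinear {p q : ℤ → K} (hp : IsUnital p) (hq : IsUnital q) {α γ : K} (hα : α ≠ 0)
    (hγ : γ ≠ 0) {m m' n n' : ℕ} (hm : IsNext m m') (hn : IsNext n n') :
    (γ - α) * stairDet (backShift γ (backShift α p)) (backShift γ⁻¹ (backShift α⁻¹ q)) m n *
        stairDet p q m' n' =
      γ * stairDet (backShift γ p) (backShift γ⁻¹ q) m' n *
          stairDet (backShift α p) (backShift α⁻¹ q) m n' -
        α * stairDet (backShift α p) (backShift α⁻¹ q) m' n *
          stairDet (backShift γ p) (backShift γ⁻¹ q) m n' := by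
  have e1 := windowDet_zpow_zpow m n p q (n - m - 2) α γ hα hγ
  rw [sub_add_cancel] at e1
  -- The rows u and v realise m → m' and n → n'; ε and η are their signs. Every product in the
  -- Plücker relation carries the factor ε η (α γ)^m, which cancels.
  have main : ∀ (u v : ℤ → K) (ε η : K), ε * η ≠ 0 →
      (∀ δ : K, δ ≠ 0 → windowDet 0 (m + n + 2)
        (consRow (fun j => δ ^ j) (consRow u (stairRow p q m (n - m - 2)))) =
        -ε * (δ ^ (m + 1) * stairDet (backShift δ p) (backShift δ⁻¹ q) m' n)) →
      (∀ δ : K, δ ≠ 0 → windowDet 0 (m + n + 2)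
        (consRow (fun j => δ ^ j) (consRow v (stairRow p q m (n - m - 2)))) =
        η * (δ ^ m * stairDet (backShift δ p) (backShift δ⁻¹ q) m n')) →
      windowDet 0 (m + n + 2) (consRow u (consRow v (stairRow p q m (n - m - 2)))) =
        ε * η * stairDet p q m' n' →
      (γ - α) * stairDet (backShift γ (backShift α p)) (backShift γ⁻¹ (backShift α⁻¹ q)) m n *
        stairDet p q m' n' =
      γ * stairDet (backShift γ p) (backShift γ⁻¹ q) m' n *
          stairDet (backShift α p) (backShift α⁻¹ q) m n' -
        α * stairDet (backShift α p) (backShift α⁻¹ q) m' n *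
          stairDet (backShift γ p) (backShift γ⁻¹ q) m n' := by
    intro u v ε η hε hu hv huv
    have h := windowDet_plucker 0 (m + n) (fun j => α ^ j) (fun j => γ ^ j) u v
      (stairRow p q m (n - m - 2))
    rw [hu α hα, hu γ hγ, hv α hα, hv γ hγ, huv, e1] at h
    have hne : ε * η * (α * γ) ^ m ≠ 0 :=
      mul_ne_zero hε (pow_ne_zero _ (mul_ne_zero hα hγ))
    refine mul_left_cancel₀ hne ?_
    simp only [stairDet] at h ⊢
    rw [mul_pow] at h ⊢
    linear_combination h
  have hs : ∀ k : ℕ, (-1 : K) ^ k ≠ 0 := fun k => pow_ne_zero _ (by simp)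
  rcases hm with rfl | rfl <;> rcases hn with rfl | rfl
  · exact main _ _ 1 1 (by simp) (fun δ hδ => windowDet_zpow_top p q hδ m n)
      (fun δ hδ => windowDet_zpow_right p q hδ m n) (by simp [← windowDet_top_right])
  · exact main _ _ 1 ((-1) ^ n) (by simp [hs]) (fun δ hδ => windowDet_zpow_top p q hδ m n)
      (fun δ hδ => windowDet_zpow_far hp q hδ m n) (by rw [windowDet_top_far hp, one_mul])
  · exact main _ _ ((-1) ^ m) 1 (by simp [hs]) (fun δ hδ => windowDet_zpow_low p hq hδ m n)
      (fun δ hδ => windowDet_zpow_right p q hδ m n) (by rw [windowDet_low_right p hq, mul_one])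
  · exact main _ _ ((-1) ^ m) ((-1) ^ n) (by simp [hs])
      (fun δ hδ => windowDet_zpow_low p hq hδ m n)
      (fun δ hδ => windowDet_zpow_far hp q hδ m n) (windowDet_low_far hp hq m n)

/-- The scaling factor of each entry splits into a row part and a column part. The exponents add up
to (n(n+1) - m(m+1))/2; the square ρ² avoids the half. -/
lemma stairDet_scale (p q : ℤ → K) {ρ : K} (hρ : ρ ≠ 0) (m n : ℕ) :
    stairDet (fun k => (ρ ^ 2) ^ k * p k) (fun k => (ρ ^ 2) ^ (-k) * q k) m n =
      ρ ^ ((n : ℤ) * (n + 1) - m * (m + 1)) * stairDet p q m n := by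
  unfold stairDet windowDet
  set M : Matrix (Fin (m + n)) (Fin (m + n)) K :=
    Matrix.of fun i j => stairRow p q m (n - m) i (0 + (j : ℕ)) with hM
  set u : Fin (m + n) → K := fun i => (ρ ^ 2) ^
    (if (i : ℕ) < m then -(2 * (i : ℤ) + 1) else (n : ℤ) - m - 2 * (i - m)) with hu
  set w : Fin (m + n) → K := fun j => (ρ ^ 2) ^ (j : ℤ) with hw
  have h1 : (Matrix.of fun i j : Fin (m + n) => stairRow (fun k => (ρ ^ 2) ^ k * p k)
      (fun k => (ρ ^ 2) ^ (-k) * q k) m (n - m) i (0 + (j : ℕ))) =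
      Matrix.of fun i j => u i * (Matrix.of fun i j => w j * M i j) i j := by
    ext i j
    simp only [Matrix.of_apply, hM, hu, hw, stairRow]
    split_ifs
    · rw [← mul_assoc, ← zpow_add₀ (pow_ne_zero 2 hρ)]
      congr 2
      ring
    · rw [← mul_assoc, ← zpow_add₀ (pow_ne_zero 2 hρ)]
      congr 2
      ring
  rw [h1, Matrix.det_mul_column, Matrix.det_mul_row, ← mul_assoc]
  congr 1
  have hpow : ∀ (l : ℕ) (f : Fin l → ℤ), ∏ i, (ρ ^ 2) ^ f i = (ρ ^ 2) ^ (∑ i, f i) := by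
    intro l f
    induction l with
    | zero => simp
    | succ l ih => rw [Fin.prod_univ_succ, Fin.sum_univ_succ, ih, zpow_add₀ (pow_ne_zero 2 hρ)]
  rw [hu, hw, hpow, hpow, ← zpow_add₀ (pow_ne_zero 2 hρ), ← zpow_natCast ρ 2, ← zpow_mul]
  congr 1
  have h2 : ∀ l : ℕ, ∑ i : Fin l, (i : ℤ) * 2 = l * (l - 1) := by
    intro l
    induction l with
    | zero => simp
    | succ l ih => rw [Fin.sum_univ_castSucc]; simp [ih]; ring
  rw [Fin.sum_univ_add, Fin.sum_univ_add]
  have h3 := h2 m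
  have h4 := h2 n
  rw [← Finset.sum_mul] at h3 h4
  simp [Finset.sum_add_distrib, Finset.sum_sub_distrib, ← Finset.mul_sum]
  linear_combination -h4 - h3

end Staircase
end QPainleveV
end

noncomputable section

namespace QPainleveV

/-! ### Generating functions and their behaviour under shifts of b and x -/

section Series

open PowerSeries

lemma differentiable_qPochInf {q : ℂ} (hq : ‖q‖ < 1) :
    Differentiable ℂ (fun z => qPochInf z q) := by
  rw [← differentiableOn_univ]
  have h : HasProdLocallyUniformlyOn (fun (j : ℕ) (z : ℂ) => 1 + -(z * q ^ j))
      (fun z => ∏' j : ℕ, (1 + -(z * q ^ j))) Set.univ := by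
    apply hasProdLocallyUniformlyOn_of_forall_compact isOpen_univ
    intro K _ hK
    obtain ⟨M, hM⟩ := hK.isBounded.exists_norm_le
    refine ((summable_geometric_of_lt_one (norm_nonneg _) hq).mul_left M).hasProdUniformlyOn_nat_one_add
      hK (.of_forall fun n x hx => ?_) (fun _ => by fun_prop)
    rw [norm_neg, norm_mul, norm_pow]
    exact mul_le_mul_of_nonneg_right (hM x hx) (by positivity)
  have h' := h.differentiableOn (.of_forall fun _ => by
    simpa [Finset.prod_fn] using DifferentiableOn.finsetProd (fun _ _ => by fun_prop)) isOpen_univ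
  simpa only [qPochInf, sub_eq_add_neg] using h'

lemma qPochInf_eq {q : ℂ} (hq : ‖q‖ < 1) (z : ℂ) :
    qPochInf z q = (1 - z) * qPochInf (z * q) q := by
  unfold qPochInf
  rw [tprod_eq_zero_mul']
  · simp only [pow_zero, mul_one, pow_succ', mul_assoc]
  · have : Summable fun n : ℕ => ‖-(z * q ^ (n + 1))‖ := by
      simp only [norm_neg, norm_mul, norm_pow, pow_succ]
      exact ((summable_geometric_of_lt_one (norm_nonneg _) hq).mul_right _).mul_left _
    simpa only [sub_eq_add_neg] using multipliable_one_add_of_summable this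

lemma qPochInf_zero (q : ℂ) : qPochInf 0 q = 1 := by simp [qPochInf]

/-- The Taylor series at `0`. -/
def taylorSeries (F : ℂ → ℂ) : PowerSeries ℂ :=
  PowerSeries.mk fun k => iteratedDeriv k F 0 / (k.factorial : ℂ)

lemma taylorSeries_mul {F G : ℂ → ℂ} (hF : AnalyticAt ℂ F 0) (hG : AnalyticAt ℂ G 0) :
    taylorSeries (fun z => F z * G z) = taylorSeries F * taylorSeries G := by
  ext k
  rw [PowerSeries.coeff_mul, Finset.Nat.sum_antidiagonal_eq_sum_range_succ_mk]
  simp only [taylorSeries, coeff_mk]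
  rw [iteratedDeriv_fun_mul hF.contDiffAt hG.contDiffAt, Finset.sum_div]
  refine Finset.sum_congr rfl fun i hi => ?_
  have hi' : i ≤ k := Nat.lt_succ_iff.1 (Finset.mem_range.1 hi)
  rw [Nat.cast_choose ℂ hi']
  have := Nat.cast_ne_zero (R := ℂ).2 k.factorial_ne_zero
  have := Nat.cast_ne_zero (R := ℂ).2 i.factorial_ne_zero
  have := Nat.cast_ne_zero (R := ℂ).2 (k - i).factorial_ne_zero
  field_simp

lemma taylorSeries_comp_mul {F : ℂ → ℂ} (hF : Differentiable ℂ F) (c : ℂ) :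
    taylorSeries (fun z => F (c * z)) = rescale c (taylorSeries F) := by
  ext k
  simp only [taylorSeries, coeff_mk, coeff_rescale]
  rw [iteratedDeriv_comp_const_mul hF.contDiff]
  simp [mul_div_assoc]

lemma taylorSeries_congr {F G : ℂ → ℂ} (h : F =ᶠ[nhds 0] G) : taylorSeries F = taylorSeries G := by
  ext k
  simp only [taylorSeries, coeff_mk, h.iteratedDeriv_eq]

lemma taylorSeries_one_sub : taylorSeries (fun z => 1 - z) = 1 - X := by
  ext k
  simp only [taylorSeries, coeff_mk, map_sub, coeff_one, coeff_X]
  rcases k with _ | _ | k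
  · simp
  · simp [iteratedDeriv_succ]
  · rw [iteratedDeriv_succ', iteratedDeriv_succ']
    have : deriv (fun z : ℂ => 1 - z) = fun _ => -1 := by
      funext z
      simp
    simp [this]

lemma taylorSeries_div {F G : ℂ → ℂ} (hF : AnalyticAt ℂ F 0) (hG : AnalyticAt ℂ G 0)
    (h0 : G 0 ≠ 0) :
    taylorSeries (fun z => F z / G z) * taylorSeries G = taylorSeries F := by
  refine (taylorSeries_mul (F := fun z => F z / G z) (hF.div hG h0) hG).symm.trans
    (taylorSeries_congr ?_)
  filter_upwards [hG.continuousAt.eventually_ne h0] with z hz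
  exact div_mul_cancel₀ _ hz

/-- The coefficients of a power series, extended by `0` to negative indices. -/
def intCoeff (P : PowerSeries ℂ) : ℤ → ℂ
  | Int.ofNat k => coeff k P
  | Int.negSucc _ => 0

lemma taylorCoeff_eq (F : ℂ → ℂ) : taylorCoeff F = intCoeff (taylorSeries F) := by
  funext k
  cases k <;> simp [taylorCoeff, intCoeff, taylorSeries]

lemma intCoeff_rescale (c : ℂ) (P : PowerSeries ℂ) :
    intCoeff (rescale c P) = fun k => c ^ k * intCoeff P k := by
  funext k
  cases k <;> simp [intCoeff, coeff_rescale]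

lemma intCoeff_one_sub_mul (α : ℂ) (P : PowerSeries ℂ) :
    intCoeff ((1 - C α * X) * P) = backShift α (intCoeff P) := by
  funext k
  rw [sub_mul, one_mul, mul_assoc]
  rcases k with (_ | k) | k
  · have : Int.ofNat 0 - 1 = Int.negSucc 0 := rfl
    simp only [backShift, this]
    simp [intCoeff]
  · have : Int.ofNat (k + 1) - 1 = Int.ofNat k := by simp
    simp only [backShift, this]
    simp [intCoeff]
  · have : Int.negSucc k - 1 = Int.negSucc (k + 1) := rfl
    simp [intCoeff, backShift, this]

lemma isUnital_intCoeff {P : PowerSeries ℂ} (h : constantCoeff P = 1) : IsUnital (intCoeff P) where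
  zero := by simpa [intCoeff] using h
  neg k hk := by
    cases k with
    | ofNat k => exact absurd hk (by simp)
    | negSucc k => rfl

/-- The power series of `(z; q)_∞`. -/
def eulerSeries (q : ℂ) : PowerSeries ℂ := taylorSeries (fun z => qPochInf z q)

/-- The power series of `(c z; q)_∞`. -/
def euler (q c : ℂ) : PowerSeries ℂ := rescale c (eulerSeries q)

lemma constantCoeff_euler (q c : ℂ) : constantCoeff (euler q c) = 1 := by
  rw [← coeff_zero_eq_constantCoeff_apply, euler, coeff_rescale, eulerSeries, taylorSeries]
  simp [qPochInf_zero]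

lemma euler_ne_zero (q c : ℂ) : euler q c ≠ 0 := fun h => by
  have := constantCoeff_euler q c
  rw [h] at this
  simp at this

lemma rescale_one_sub (c α : ℂ) : rescale c (1 - C α * X) = 1 - C (c * α) * X := by
  rw [map_sub, map_mul, map_one, rescale_X, ← mul_assoc, map_mul]
  congr 2
  rw [show rescale c (C α) = C α by ext k; cases k <;> simp [coeff_rescale, coeff_C], mul_comm]

lemma eulerSeries_eq {q : ℂ} (hq : ‖q‖ < 1) :
    eulerSeries q = (1 - X) * rescale q (eulerSeries q) := by
  have hd := differentiable_qPochInf hq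
  have ha : AnalyticAt ℂ (fun z => qPochInf (q * z) q) 0 :=
    Differentiable.analyticAt (f := fun z => qPochInf (q * z) q)
      (hd.comp (differentiable_id.const_mul q)) 0
  have hb : AnalyticAt ℂ (fun z : ℂ => 1 - z) 0 := by fun_prop
  have : (fun z => qPochInf z q) = fun z => (1 - z) * qPochInf (q * z) q := by
    funext z
    rw [qPochInf_eq hq, mul_comm z q]
  conv_lhs => rw [eulerSeries, this, taylorSeries_mul hb ha, taylorSeries_one_sub,
    taylorSeries_comp_mul hd]
  rfl

lemma rescale_euler (q c d : ℂ) : rescale d (euler q c) = euler q (d * c) := by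
  rw [euler, euler, rescale_rescale, mul_comm]

lemma euler_eq {q : ℂ} (hq : ‖q‖ < 1) (c : ℂ) :
    euler q c = (1 - C c * X) * euler q (c * q) := by
  conv_lhs => rw [euler, eulerSeries_eq hq, map_mul]
  rw [show (1 - X : PowerSeries ℂ) = 1 - C 1 * X by simp, rescale_one_sub, mul_one]
  congr 1
  rw [show rescale q (eulerSeries q) = euler q q from rfl, rescale_euler]

lemma analyticAt_qPochInf {q : ℂ} (hq : ‖q‖ < 1) (c z : ℂ) :
    AnalyticAt ℂ (fun t => qPochInf (c * t) q) z :=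
  Differentiable.analyticAt (f := fun z => qPochInf (c * z) q)
    ((differentiable_qPochInf hq).comp (differentiable_id.const_mul c)) z

lemma taylorSeries_qPochInf_mul {q : ℂ} (hq : ‖q‖ < 1) (c d : ℂ) :
    taylorSeries (fun t => qPochInf (c * t) q * qPochInf (d * t) q) = euler q c * euler q d := by
  rw [taylorSeries_mul (analyticAt_qPochInf hq c 0) (analyticAt_qPochInf hq d 0),
    taylorSeries_comp_mul (differentiable_qPochInf hq),
    taylorSeries_comp_mul (differentiable_qPochInf hq)]
  rfl

lemma taylorSeries_qPochInf_div {q : ℂ} (hq : ‖q‖ < 1) (c d c' d' : ℂ) :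
    taylorSeries (fun t => qPochInf (c * t) q * qPochInf (d * t) q /
      (qPochInf (c' * t) q * qPochInf (d' * t) q)) * (euler q c' * euler q d') =
      euler q c * euler q d := by
  rw [← taylorSeries_qPochInf_mul hq, ← taylorSeries_qPochInf_mul hq c d]
  exact taylorSeries_div ((analyticAt_qPochInf hq c 0).mul (analyticAt_qPochInf hq d 0))
    ((analyticAt_qPochInf hq c' 0).mul (analyticAt_qPochInf hq d' 0)) (by simp [qPochInf_zero])

variable {r : ℂ}

/-- The power series of `pGen`. -/
def pSeries (r b x : ℂ) : PowerSeries ℂ := taylorSeries (pGen r b x)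

/-- The power series of `qGen`. -/
def qSeries (r b x : ℂ) : PowerSeries ℂ := taylorSeries (qGen r b x)

lemma pSeries_mul (hr : ‖r ^ 4‖ < 1) (b x : ℂ) :
    pSeries r b x * (euler (r ^ 4) (-(r * x)) * euler (r ^ 4) (-(r ^ 3 * x⁻¹))) =
      euler (r ^ 4) (r * b) * euler (r ^ 4) (r ^ 3 * b) := by
  have h := taylorSeries_qPochInf_div hr (r * b) (r ^ 3 * b) (-(r * x)) (-(r ^ 3 * x⁻¹))
  simp only [neg_mul] at h
  exact h

lemma qSeries_mul (hr : ‖r ^ 4‖ < 1) (b x : ℂ) :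
    qSeries r b x * (euler (r ^ 4) (r * b⁻¹) * euler (r ^ 4) (r ^ 3 * b⁻¹)) =
      euler (r ^ 4) (-(r * x)) * euler (r ^ 4) (-(r ^ 3 * x⁻¹)) := by
  have h := taylorSeries_qPochInf_div hr (-(r * x)) (-(r ^ 3 * x⁻¹)) (r * b⁻¹) (r ^ 3 * b⁻¹)
  simp only [neg_mul] at h
  exact h

lemma pCoeff_eq (r b x : ℂ) : pCoeff r b x = intCoeff (pSeries r b x) := taylorCoeff_eq _

lemma qCoeff_eq (r b x : ℂ) : qCoeff r b x = intCoeff (qSeries r b x) := taylorCoeff_eq _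

lemma isUnital_pCoeff (hr : ‖r ^ 4‖ < 1) (b x : ℂ) : IsUnital (pCoeff r b x) := by
  rw [pCoeff_eq]
  refine isUnital_intCoeff ?_
  have := congrArg constantCoeff (pSeries_mul hr b x)
  simpa [constantCoeff_euler] using this

lemma isUnital_qCoeff (hr : ‖r ^ 4‖ < 1) (b x : ℂ) : IsUnital (qCoeff r b x) := by
  rw [qCoeff_eq]
  refine isUnital_intCoeff ?_
  have := congrArg constantCoeff (qSeries_mul hr b x)
  simpa [constantCoeff_euler] using this

/-- The numerator for q^{-1/2}b has nodes q^{-1/4}b and q^{1/4}b in place of q^{1/4}b and q^{3/4}b;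
by (z;q)_∞ = (1 - z)(zq;q)_∞ this is one additional factor 1 - q^{-1/4}bt. -/
lemma pCoeff_shift_b (hr0 : r ≠ 0) (hr : ‖r ^ 4‖ < 1) (b x : ℂ) :
    pCoeff r ((r ^ 2)⁻¹ * b) x = backShift (r⁻¹ * b) (pCoeff r b x) := by
  rw [pCoeff_eq, pCoeff_eq, ← intCoeff_one_sub_mul]
  congr 1
  refine mul_right_cancel₀ (mul_ne_zero (euler_ne_zero (r ^ 4) (-(r * x)))
    (euler_ne_zero (r ^ 4) (-(r ^ 3 * x⁻¹)))) ?_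
  rw [mul_assoc, pSeries_mul hr, pSeries_mul hr,
    show r * ((r ^ 2)⁻¹ * b) = r⁻¹ * b by field_simp, show r ^ 3 * ((r ^ 2)⁻¹ * b) = r * b by
      field_simp, euler_eq hr (r⁻¹ * b), show r⁻¹ * b * r ^ 4 = r ^ 3 * b by field_simp]
  ring

lemma qCoeff_shift_b (hr0 : r ≠ 0) (hr : ‖r ^ 4‖ < 1) {b : ℂ} (hb : b ≠ 0) (x : ℂ) :
    qCoeff r ((r ^ 2)⁻¹ * b) x = backShift (r⁻¹ * b)⁻¹ (qCoeff r b x) := by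
  rw [qCoeff_eq, qCoeff_eq, ← intCoeff_one_sub_mul]
  congr 1
  have h := qSeries_mul hr ((r ^ 2)⁻¹ * b) x
  have h' := qSeries_mul hr b x
  rw [show r * ((r ^ 2)⁻¹ * b)⁻¹ = r ^ 3 * b⁻¹ by field_simp,
    show r ^ 3 * ((r ^ 2)⁻¹ * b)⁻¹ = r ^ 5 * b⁻¹ by field_simp] at h
  rw [euler_eq hr (r * b⁻¹), show r * b⁻¹ * r ^ 4 = r ^ 5 * b⁻¹ by ring] at h'
  refine mul_right_cancel₀ (mul_ne_zero (euler_ne_zero (r ^ 4) (r ^ 3 * b⁻¹))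
    (euler_ne_zero (r ^ 4) (r ^ 5 * b⁻¹))) ?_
  rw [h, ← h', show (r⁻¹ * b)⁻¹ = r * b⁻¹ by field_simp]
  ring

/-- Shifting b and x together amounts to t → q^{-1/2}t, except in the factor with x⁻¹, which moves
the other way and loses its first term. -/
lemma pCoeff_shift_bx (hr0 : r ≠ 0) (hr : ‖r ^ 4‖ < 1) (b : ℂ) {x : ℂ} (hx : x ≠ 0) :
    pCoeff r ((r ^ 2)⁻¹ * b) ((r ^ 2)⁻¹ * x) =
      fun k => (r⁻¹ ^ 2) ^ k * backShift (-(r ^ 3 * x⁻¹)) (pCoeff r b x) k := by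
  rw [pCoeff_eq, pCoeff_eq, ← intCoeff_one_sub_mul, ← intCoeff_rescale]
  congr 1
  have h := pSeries_mul hr ((r ^ 2)⁻¹ * b) ((r ^ 2)⁻¹ * x)
  have h' := congrArg (rescale (r⁻¹ ^ 2)) (pSeries_mul hr b x)
  simp only [map_mul, rescale_euler] at h'
  rw [euler_eq hr (r⁻¹ ^ 2 * -(r ^ 3 * x⁻¹))] at h'
  rw [show -(r * ((r ^ 2)⁻¹ * x)) = r⁻¹ ^ 2 * -(r * x) by ring,
    show -(r ^ 3 * ((r ^ 2)⁻¹ * x)⁻¹) = r⁻¹ ^ 2 * -(r ^ 3 * x⁻¹) * r ^ 4 by field_simp,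
    show r * ((r ^ 2)⁻¹ * b) = r⁻¹ ^ 2 * (r * b) by ring,
    show r ^ 3 * ((r ^ 2)⁻¹ * b) = r⁻¹ ^ 2 * (r ^ 3 * b) by ring] at h
  refine mul_right_cancel₀ (mul_ne_zero (euler_ne_zero (r ^ 4) (r⁻¹ ^ 2 * -(r * x)))
    (euler_ne_zero (r ^ 4) (r⁻¹ ^ 2 * -(r ^ 3 * x⁻¹) * r ^ 4))) ?_
  rw [h, ← h', map_mul (rescale _), rescale_one_sub]
  ring

/-- Here b⁻¹ forces the opposite rescaling t → q^{1/2}t, and the factor with x gains one term. The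
node is the inverse of that for p, exactly as the staircase determinants require. -/
lemma qCoeff_shift_bx (hr0 : r ≠ 0) (hr : ‖r ^ 4‖ < 1) {b x : ℂ} (hb : b ≠ 0) (hx : x ≠ 0) :
    qCoeff r ((r ^ 2)⁻¹ * b) ((r ^ 2)⁻¹ * x) =
      fun k => (r⁻¹ ^ 2) ^ (-k) * backShift (-(r ^ 3 * x⁻¹))⁻¹ (qCoeff r b x) k := by
  have hfun : (fun k => (r⁻¹ ^ 2) ^ (-k) * backShift (-(r ^ 3 * x⁻¹))⁻¹ (qCoeff r b x) k) =
      fun k => (r ^ 2) ^ k * backShift (-(r ^ 3 * x⁻¹))⁻¹ (qCoeff r b x) k := by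
    funext k
    rw [zpow_neg, ← inv_zpow, inv_pow, inv_inv]
  rw [hfun, qCoeff_eq, qCoeff_eq, ← intCoeff_one_sub_mul, ← intCoeff_rescale]
  congr 1
  have h := qSeries_mul hr ((r ^ 2)⁻¹ * b) ((r ^ 2)⁻¹ * x)
  have h' := congrArg (rescale (r ^ 2)) (qSeries_mul hr b x)
  simp only [map_mul, rescale_euler] at h'
  rw [show -(r * ((r ^ 2)⁻¹ * x)) = -(r⁻¹ * x) by field_simp, euler_eq hr (-(r⁻¹ * x)),
    show -(r⁻¹ * x) * r ^ 4 = r ^ 2 * -(r * x) by field_simp,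
    show -(r ^ 3 * ((r ^ 2)⁻¹ * x)⁻¹) = r ^ 2 * -(r ^ 3 * x⁻¹) by field_simp,
    show r * ((r ^ 2)⁻¹ * b)⁻¹ = r ^ 2 * (r * b⁻¹) by field_simp,
    show r ^ 3 * ((r ^ 2)⁻¹ * b)⁻¹ = r ^ 2 * (r ^ 3 * b⁻¹) by field_simp] at h
  refine mul_right_cancel₀ (mul_ne_zero (euler_ne_zero (r ^ 4) (r ^ 2 * (r * b⁻¹)))
    (euler_ne_zero (r ^ 4) (r ^ 2 * (r ^ 3 * b⁻¹)))) ?_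
  rw [h, map_mul, rescale_one_sub,
    show r ^ 2 * (-(r ^ 3 * x⁻¹))⁻¹ = -(r⁻¹ * x) by field_simp]
  linear_combination -(1 - C (-(r⁻¹ * x)) * X) * h'

/-- The substitution x → q^{1/2}x⁻¹ fixes y: it exchanges the two factors of the denominator. -/
lemma pCoeff_symm (hr0 : r ≠ 0) (hr : ‖r ^ 4‖ < 1) (b : ℂ) {x : ℂ} (hx : x ≠ 0) :
    pCoeff r b (r ^ 2 * x⁻¹) = pCoeff r b x := by
  rw [pCoeff_eq, pCoeff_eq]
  congr 1
  have h := pSeries_mul hr b (r ^ 2 * x⁻¹)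
  rw [show -(r * (r ^ 2 * x⁻¹)) = -(r ^ 3 * x⁻¹) by ring,
    show -(r ^ 3 * (r ^ 2 * x⁻¹)⁻¹) = -(r * x) by field_simp, ← pSeries_mul hr b x,
    mul_comm (euler _ (-(r * x)))] at h
  exact mul_right_cancel₀ (mul_ne_zero (euler_ne_zero _ _) (euler_ne_zero _ _)) h

lemma qCoeff_symm (hr0 : r ≠ 0) (hr : ‖r ^ 4‖ < 1) (b : ℂ) {x : ℂ} (hx : x ≠ 0) :
    qCoeff r b (r ^ 2 * x⁻¹) = qCoeff r b x := by
  rw [qCoeff_eq, qCoeff_eq]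
  congr 1
  have h := qSeries_mul hr b (r ^ 2 * x⁻¹)
  rw [show -(r * (r ^ 2 * x⁻¹)) = -(r ^ 3 * x⁻¹) by ring,
    show -(r ^ 3 * (r ^ 2 * x⁻¹)⁻¹) = -(r * x) by field_simp,
    mul_comm (euler _ (-(r ^ 3 * x⁻¹))), ← qSeries_mul hr b x] at h
  exact mul_right_cancel₀ (mul_ne_zero (euler_ne_zero _ _) (euler_ne_zero _ _)) h

end Series
end QPainleveV
end

noncomputable section

namespace QPainleveV

/-! ### Extension to all integer indices -/

section Tau

variable {K : Type*} [Field K]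

/-- Neighbouring integers. -/
def IsAdj (m m' : ℤ) : Prop := m' = m + 1 ∨ m' = m - 1

lemma IsAdj.symm {m m' : ℤ} (h : IsAdj m m') : IsAdj m' m := by
  rcases h with rfl | rfl
  · right; ring
  · left; ring

lemma isAdj_sub_one (m : ℤ) : IsAdj (m - 1) m := Or.inl (by ring)

lemma isAdj_sub_one' (m : ℤ) : IsAdj m (m - 1) := Or.inr rfl

lemma reflIndex_cast (m : ℤ) : (reflIndex m : ℤ) = if 0 ≤ m then m else -m - 1 := by
  cases m with
  | ofNat k => simp [reflIndex]
  | negSucc k =>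
    rw [if_neg (by simp)]
    simp only [reflIndex, Int.negSucc_eq]
    ring

/-- The reflection k → -k-1 folds ℤ onto ℕ and turns the edge between -1 and 0 into a loop at 0,
which is what truncated subtraction gives. -/
lemma IsAdj.isNext {m m' : ℤ} (h : IsAdj m m') : IsNext (reflIndex m) (reflIndex m') := by
  have h1 := reflIndex_cast m
  have h2 := reflIndex_cast m'
  unfold IsNext
  rcases h with rfl | rfl <;> split_ifs at h1 h2 <;> omega

lemma reflIndex_mul_add_one (m : ℤ) :
    (reflIndex m : ℤ) * (reflIndex m + 1) = m * (m + 1) := by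
  rw [reflIndex_cast]
  split_ifs
  · rfl
  · ring

/-- The weight of the staircase determinant `R_{m,n}`. -/
def weight (m n : ℤ) : ℤ := n * (n + 1) - m * (m + 1)

/-- The staircase determinants, extended to all integers. -/
def tau (p q : ℤ → ℂ) (m n : ℤ) : ℂ :=
  reflSign m * reflSign n * stairDet p q (reflIndex m) (reflIndex n)

lemma R_eq_tau (r b x : ℂ) (m n : ℤ) : R r b x m n = tau (pCoeff r b x) (qCoeff r b x) m n := by
  unfold R tau stairDet windowDet RMatrix
  congr 2
  ext i j
  simp only [Matrix.of_apply, stairRow, zero_add]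
  split_ifs
  · rfl
  · congr 1
    ring

lemma tau_scale (p q : ℤ → ℂ) {ρ : ℂ} (hρ : ρ ≠ 0) (m n : ℤ) :
    tau (fun k => (ρ ^ 2) ^ k * p k) (fun k => (ρ ^ 2) ^ (-k) * q k) m n =
      ρ ^ weight m n * tau p q m n := by
  unfold tau weight
  rw [stairDet_scale p q hρ, reflIndex_mul_add_one, reflIndex_mul_add_one]
  ring

/-- All three products carry the same four signs, so the reflected signs play no role. -/
lemma tau_bilinear {p q : ℤ → ℂ} (hp : IsUnital p) (hq : IsUnital q) {α γ : ℂ} (hα : α ≠ 0)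
    (hγ : γ ≠ 0) {m m' n n' : ℤ} (hm : IsAdj m m') (hn : IsAdj n n') :
    (γ - α) * tau (backShift γ (backShift α p)) (backShift γ⁻¹ (backShift α⁻¹ q)) m n *
        tau p q m' n' =
      γ * tau (backShift γ p) (backShift γ⁻¹ q) m' n *
          tau (backShift α p) (backShift α⁻¹ q) m n' -
        α * tau (backShift α p) (backShift α⁻¹ q) m' n *
          tau (backShift γ p) (backShift γ⁻¹ q) m n' := by
  have h := stairDet_bilinear hp hq hα hγ hm.isNext hn.isNext
  unfold tau
  linear_combination (reflSign m * reflSign n * reflSign m' * reflSign n') * h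

end Tau

/-! ### The three bilinear relations for R_{m,n} -/

section Relations

variable {r : ℂ} (hr0 : r ≠ 0) (hr : ‖r ^ 4‖ < 1) {b : ℂ} (hb : b ≠ 0) {x : ℂ} (hx : x ≠ 0)
include hr0 hr

include hb in
lemma tau_shift_b (x : ℂ) (m n : ℤ) :
    tau (backShift (r⁻¹ * b) (pCoeff r b x)) (backShift (r⁻¹ * b)⁻¹ (qCoeff r b x)) m n =
      R r ((r ^ 2)⁻¹ * b) x m n := by
  rw [R_eq_tau, pCoeff_shift_b hr0 hr, qCoeff_shift_b hr0 hr hb]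

include hb hx

lemma tau_shift_down (m n : ℤ) :
    tau (backShift (-(r ^ 3 * x⁻¹)) (pCoeff r b x)) (backShift (-(r ^ 3 * x⁻¹))⁻¹ (qCoeff r b x))
      m n = r ^ weight m n * R r ((r ^ 2)⁻¹ * b) ((r ^ 2)⁻¹ * x) m n := by
  rw [R_eq_tau, pCoeff_shift_bx hr0 hr b hx, qCoeff_shift_bx hr0 hr hb hx,
    tau_scale _ _ (inv_ne_zero hr0), inv_zpow, ← mul_assoc,
    mul_inv_cancel₀ (zpow_ne_zero _ hr0), one_mul]

omit hb in
lemma R_symm (m n : ℤ) : R r b (r ^ 2 * x⁻¹) m n = R r b x m n := by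
  rw [R_eq_tau, R_eq_tau, pCoeff_symm hr0 hr b hx, qCoeff_symm hr0 hr b hx]

/-- The symmetry x → q^{1/2}x⁻¹ turns the downward shift into the upward one. -/
lemma tau_shift_up (m n : ℤ) :
    tau (backShift (-(r * x)) (pCoeff r b x)) (backShift (-(r * x))⁻¹ (qCoeff r b x)) m n =
      r ^ weight m n * R r ((r ^ 2)⁻¹ * b) (r ^ 2 * x) m n := by
  have hr2 : r ^ 2 ≠ 0 := pow_ne_zero 2 hr0
  have h := tau_shift_down hr0 hr hb (x := r ^ 2 * x⁻¹) (mul_ne_zero hr2 (inv_ne_zero hx)) m n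
  rw [show r ^ 3 * (r ^ 2 * x⁻¹)⁻¹ = r * x by field_simp, pCoeff_symm hr0 hr b hx,
    qCoeff_symm hr0 hr b hx] at h
  rw [h, ← R_symm hr0 hr (mul_ne_zero hr2 hx),
    show r ^ 2 * (r ^ 2 * x)⁻¹ = (r ^ 2)⁻¹ * (r ^ 2 * x⁻¹) by field_simp]

lemma tau_shift_down_b (m n : ℤ) :
    tau (backShift (-(r ^ 3 * x⁻¹)) (backShift (r⁻¹ * b) (pCoeff r b x)))
      (backShift (-(r ^ 3 * x⁻¹))⁻¹ (backShift (r⁻¹ * b)⁻¹ (qCoeff r b x))) m n =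
      r ^ weight m n * R r ((r ^ 2)⁻¹ * ((r ^ 2)⁻¹ * b)) ((r ^ 2)⁻¹ * x) m n := by
  rw [← pCoeff_shift_b hr0 hr, ← qCoeff_shift_b hr0 hr hb,
    tau_shift_down hr0 hr (mul_ne_zero (inv_ne_zero (pow_ne_zero 2 hr0)) hb) hx]

lemma tau_shift_up_b (m n : ℤ) :
    tau (backShift (-(r * x)) (backShift (r⁻¹ * b) (pCoeff r b x)))
      (backShift (-(r * x))⁻¹ (backShift (r⁻¹ * b)⁻¹ (qCoeff r b x))) m n =
      r ^ weight m n * R r ((r ^ 2)⁻¹ * ((r ^ 2)⁻¹ * b)) (r ^ 2 * x) m n := by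
  rw [← pCoeff_shift_b hr0 hr, ← qCoeff_shift_b hr0 hr hb,
    tau_shift_up hr0 hr (mul_ne_zero (inv_ne_zero (pow_ne_zero 2 hr0)) hb) hx]

/-- The upward shift is applied at the point already shifted down: x returns and b is shifted twice.
Rescaling commutes with `backShift` once the node is rescaled too, and each shift contributes one
weight. -/
lemma tau_shift_up_down (m n : ℤ) :
    tau (backShift (-(r * x)) (backShift (-(r ^ 3 * x⁻¹)) (pCoeff r b x)))
      (backShift (-(r * x))⁻¹ (backShift (-(r ^ 3 * x⁻¹))⁻¹ (qCoeff r b x))) m n =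
      r ^ weight m n * r ^ weight m n * R r ((r ^ 2)⁻¹ * ((r ^ 2)⁻¹ * b)) x m n := by
  have hr2 : r ^ 2 ≠ 0 := pow_ne_zero 2 hr0
  have h := tau_shift_up hr0 hr (mul_ne_zero (inv_ne_zero hr2) hb)
    (mul_ne_zero (inv_ne_zero hr2) hx) m n
  rw [mul_inv_cancel_left₀ hr2, pCoeff_shift_bx hr0 hr b hx, qCoeff_shift_bx hr0 hr hb hx] at h
  have hP : ∀ P : ℤ → ℂ, (backShift (-(r * ((r ^ 2)⁻¹ * x))) fun k => (r⁻¹ ^ 2) ^ k * P k) =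
      fun k => (r⁻¹ ^ 2) ^ k * backShift (-(r * x)) P k := by
    intro P
    funext k
    simp only [backShift]
    rw [zpow_sub_one₀ (pow_ne_zero 2 (inv_ne_zero hr0))]
    field_simp
  have hQ : ∀ P : ℤ → ℂ, (backShift (-(r * ((r ^ 2)⁻¹ * x)))⁻¹
      fun k => (r⁻¹ ^ 2) ^ (-k) * P k) =
      fun k => (r⁻¹ ^ 2) ^ (-k) * backShift (-(r * x))⁻¹ P k := by
    intro P
    funext k
    simp only [backShift]
    rw [show -(k - 1) = -k + 1 by ring, zpow_add_one₀ (pow_ne_zero 2 (inv_ne_zero hr0))]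
    field_simp
  rw [hP, hQ, tau_scale _ _ (inv_ne_zero hr0), inv_zpow] at h
  rw [mul_assoc, ← h, ← mul_assoc, mul_inv_cancel₀ (zpow_ne_zero _ hr0), one_mul]

variable {m m' n n' : ℤ} (hm : IsAdj m m') (hn : IsAdj n n')
include hm hn

/-- Nodes q^{-1/4}b and -q^{1/4}x. -/
lemma R_bilinear_up :
    (1 + (r ^ 2)⁻¹ * b * x⁻¹) * (R r ((r ^ 2)⁻¹ * ((r ^ 2)⁻¹ * b)) (r ^ 2 * x) m n *
        R r b x m' n') =
      r ^ (m * (m + 1) - m' * (m' + 1)) *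
          (R r ((r ^ 2)⁻¹ * b) (r ^ 2 * x) m' n * R r ((r ^ 2)⁻¹ * b) x m n') +
        (r ^ 2)⁻¹ * b * x⁻¹ * r ^ (n' * (n' + 1) - n * (n + 1)) *
          (R r ((r ^ 2)⁻¹ * b) x m' n * R r ((r ^ 2)⁻¹ * b) (r ^ 2 * x) m n') := by
  have h := tau_bilinear (isUnital_pCoeff hr b x) (isUnital_qCoeff hr b x)
    (mul_ne_zero (inv_ne_zero hr0) hb) (neg_ne_zero.2 (mul_ne_zero hr0 hx)) hm hn
  rw [tau_shift_up_b hr0 hr hb hx, tau_shift_b hr0 hr hb, tau_shift_b hr0 hr hb,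
    tau_shift_up hr0 hr hb hx, tau_shift_up hr0 hr hb hx, ← R_eq_tau,
    show weight m' n = weight m n + (m * (m + 1) - m' * (m' + 1)) by unfold weight; ring,
    show weight m n' = weight m n + (n' * (n' + 1) - n * (n + 1)) by unfold weight; ring,
    zpow_add₀ hr0, zpow_add₀ hr0] at h
  refine mul_left_cancel₀ (mul_ne_zero (zpow_ne_zero (weight m n) hr0)
    (neg_ne_zero.2 (mul_ne_zero hr0 hx))) ?_
  have e : (r * x) * ((r ^ 2)⁻¹ * b * x⁻¹) = r⁻¹ * b := by field_simp
  generalize (r ^ 2)⁻¹ * b * x⁻¹ = u at *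
  generalize r⁻¹ * b = v at *
  subst e
  linear_combination h

/-- Nodes q^{-1/4}b and -q^{3/4}/x', where x' = q^{1/2}x, so that the shift leads from x' down to x.
-/
lemma R_bilinear_down :
    (1 + r ^ 2 * b⁻¹ * x⁻¹) * (R r ((r ^ 2)⁻¹ * ((r ^ 2)⁻¹ * b)) x m n *
        R r b (r ^ 2 * x) m' n') =
      r ^ (n' * (n' + 1) - n * (n + 1)) *
          (R r ((r ^ 2)⁻¹ * b) (r ^ 2 * x) m' n * R r ((r ^ 2)⁻¹ * b) x m n') +
        r ^ 2 * b⁻¹ * x⁻¹ * r ^ (m * (m + 1) - m' * (m' + 1)) *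
          (R r ((r ^ 2)⁻¹ * b) x m' n * R r ((r ^ 2)⁻¹ * b) (r ^ 2 * x) m n') := by
  have hr2 : r ^ 2 ≠ 0 := pow_ne_zero 2 hr0
  have hx' : r ^ 2 * x ≠ 0 := mul_ne_zero hr2 hx
  have h := tau_bilinear (isUnital_pCoeff hr b (r ^ 2 * x)) (isUnital_qCoeff hr b (r ^ 2 * x))
    (mul_ne_zero (inv_ne_zero hr0) hb)
    (neg_ne_zero.2 (mul_ne_zero (pow_ne_zero 3 hr0) (inv_ne_zero hx'))) hm hn
  rw [tau_shift_down_b hr0 hr hb hx', tau_shift_b hr0 hr hb, tau_shift_b hr0 hr hb,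
    tau_shift_down hr0 hr hb hx', tau_shift_down hr0 hr hb hx', ← R_eq_tau,
    inv_mul_cancel_left₀ hr2,
    show weight m' n = weight m n + (m * (m + 1) - m' * (m' + 1)) by unfold weight; ring,
    show weight m n' = weight m n + (n' * (n' + 1) - n * (n + 1)) by unfold weight; ring,
    zpow_add₀ hr0, zpow_add₀ hr0] at h
  refine mul_left_cancel₀ (mul_ne_zero (zpow_ne_zero (weight m n) hr0)
    (neg_ne_zero.2 (mul_ne_zero (inv_ne_zero hr0) hb))) ?_
  have e : (r⁻¹ * b) * (r ^ 2 * b⁻¹ * x⁻¹) = r ^ 3 * (r ^ 2 * x)⁻¹ := by field_simp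
  generalize r ^ 2 * b⁻¹ * x⁻¹ = u at *
  rw [← e] at h
  linear_combination h

/-- Both nodes come from x' = q^{1/2}x, namely ξ = -q^{3/4}/x' and η = -q^{1/4}x'. The hypothesis
says that they differ. The relation is used twice, for (m,n) and (m',n') in either order, to
eliminate one of the mixed products. -/
lemma R_bilinear_up_down (hx2 : r ^ 2 * x ^ 2 ≠ 1) :
    R r ((r ^ 2)⁻¹ * ((r ^ 2)⁻¹ * b)) (r ^ 2 * x) m n * R r b (r ^ 2 * x) m' n' +
        (r ^ 2)⁻¹ * (x ^ 2)⁻¹ *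
          (r ^ (m * (m + 1) - m' * (m' + 1)) * r ^ (n' * (n' + 1) - n * (n + 1))) ^ 2 *
          (R r ((r ^ 2)⁻¹ * ((r ^ 2)⁻¹ * b)) (r ^ 2 * x) m' n' * R r b (r ^ 2 * x) m n) =
      (1 + (r ^ 2)⁻¹ * (x ^ 2)⁻¹) *
        (r ^ (m * (m + 1) - m' * (m' + 1)) * r ^ (n' * (n' + 1) - n * (n + 1))) *
        (R r ((r ^ 2)⁻¹ * b) (r ^ 2 * (r ^ 2 * x)) m' n * R r ((r ^ 2)⁻¹ * b) x m n') := by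
  have hr2 : r ^ 2 ≠ 0 := pow_ne_zero 2 hr0
  have hx' : r ^ 2 * x ≠ 0 := mul_ne_zero hr2 hx
  have hξ : -(r ^ 3 * (r ^ 2 * x)⁻¹) ≠ 0 :=
    neg_ne_zero.2 (mul_ne_zero (pow_ne_zero 3 hr0) (inv_ne_zero hx'))
  have hη : -(r * (r ^ 2 * x)) ≠ 0 := neg_ne_zero.2 (mul_ne_zero hr0 hx')
  have h := tau_bilinear (isUnital_pCoeff hr b (r ^ 2 * x)) (isUnital_qCoeff hr b (r ^ 2 * x))
    hξ hη hm hn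
  have h' := tau_bilinear (isUnital_pCoeff hr b (r ^ 2 * x)) (isUnital_qCoeff hr b (r ^ 2 * x))
    hξ hη hm.symm hn.symm
  simp only [tau_shift_up_down hr0 hr hb hx', tau_shift_up hr0 hr hb hx',
    tau_shift_down hr0 hr hb hx', ← R_eq_tau, inv_mul_cancel_left₀ hr2] at h h'
  have w1 : weight m' n = weight m n + (m * (m + 1) - m' * (m' + 1)) := by unfold weight; ring
  have w2 : weight m n' = weight m n + (n' * (n' + 1) - n * (n + 1)) := by unfold weight; ring
  have w3 : weight m' n' = weight m n + (m * (m + 1) - m' * (m' + 1)) +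
    (n' * (n' + 1) - n * (n + 1)) := by unfold weight; ring
  rw [w1, w2] at h h'
  rw [w3] at h'
  simp only [zpow_add₀ hr0] at h h'
  have e : r ^ 3 * (r ^ 2 * x)⁻¹ = (r * (r ^ 2 * x)) * ((r ^ 2)⁻¹ * (x ^ 2)⁻¹) := by field_simp
  have hne : 1 - (r ^ 2)⁻¹ * (x ^ 2)⁻¹ ≠ 0 := by
    intro h0
    apply hx2
    field_simp at h0
    linear_combination h0
  rw [e] at h h'
  generalize (r ^ 2)⁻¹ * (x ^ 2)⁻¹ = u at *
  refine mul_left_cancel₀ (mul_ne_zero (mul_ne_zero (zpow_ne_zero (weight m n) hr0)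
    (zpow_ne_zero (weight m n) hr0)) (mul_ne_zero hη hne)) ?_
  -- Since ξ = uη, one mixed product gets the coefficient -ξ + uη = 0 and the other η(1 - u²),
  -- whence 1 + u after division by η(1 - u).
  linear_combination h + u * h'

end Relations
end QPainleveV
end

noncomputable section

namespace QPainleveV

/-! ### Nonvanishing of R_{m,n} through its behaviour as x → ∞ -/

section Leading

open PowerSeries

/-- By the recursion, κ^j F(k - j) is F(k) times a polynomial of degree j in w^k. Up to nonzero row
and column factors the matrix is thus a Vandermonde matrix in the distinct nodes w^{l_i}. -/
lemma det_sub_ne_zero {w κ : ℂ} (hw0 : w ≠ 0) (hw : ∀ k : ℕ, k ≠ 0 → w ^ k ≠ 1) (hκ : κ ≠ 0)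
    {F : ℤ → ℂ} (hF : IsUnital F) (hrec : ∀ k, (1 - w ^ k) * F k = κ * F (k - 1)) {n : ℕ}
    (l : Fin n → ℕ) (hl : Function.Injective l) :
    (Matrix.of fun i j : Fin n => F ((l i : ℤ) - (j : ℕ))).det ≠ 0 := by
  have hF0 : ∀ k : ℕ, F k ≠ 0 := by
    intro k
    induction k with
    | zero => simp [hF.zero]
    | succ k ih =>
      have h := hrec (k + 1 : ℕ)
      rw [show ((k + 1 : ℕ) : ℤ) - 1 = k by simp] at h
      intro h0
      rw [h0, mul_zero] at h
      exact mul_ne_zero hκ ih h.symm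
  -- For h > k both sides vanish, the right one through the factor t = k.
  have hstep : ∀ k h : ℕ, κ ^ h * F ((k : ℤ) - h) =
      F k * ∏ t ∈ Finset.range h, (-(w ^ t)⁻¹ * (w ^ k - w ^ t)) := by
    intro k h
    induction h with
    | zero => simp
    | succ h ih =>
      rw [Finset.prod_range_succ, ← mul_assoc, ← ih, pow_succ,
        show (k : ℤ) - (h + 1 : ℕ) = k - h - 1 by push_cast; ring, mul_assoc, ← hrec,
        zpow_sub₀ hw0, zpow_natCast, zpow_natCast]
      have := pow_ne_zero h hw0
      field_simp
      ring
  set P : Fin n → Polynomial ℂ := fun j =>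
    ∏ t ∈ Finset.range (j : ℕ), (Polynomial.X - Polynomial.C (w ^ t)) with hP
  have hmonic : ∀ j, (P j).Monic := fun j =>
    Polynomial.monic_prod_of_monic _ _ fun t _ => Polynomial.monic_X_sub_C _
  have hdeg : ∀ j, (P j).natDegree = j := by
    intro j
    rw [hP, Polynomial.natDegree_prod_of_monic _ _ fun t _ => Polynomial.monic_X_sub_C _]
    simp only [Polynomial.natDegree_X_sub_C]
    simp
  have hdet := Matrix.det_eval_matrixOfPolynomials_eq_det_vandermonde (fun i => w ^ l i) P hdeg
    hmonic
  have hinj : Function.Injective fun i => w ^ l i := by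
    have key : ∀ a b : ℕ, a ≤ b → w ^ a = w ^ b → a = b := by
      intro a b hab h
      obtain ⟨c, rfl⟩ := Nat.exists_eq_add_of_le hab
      by_contra hne
      refine hw c (by omega) ?_
      rw [pow_add] at h
      exact mul_left_cancel₀ (pow_ne_zero a hw0) (by rw [← h, mul_one])
    intro i j hij
    apply hl
    rcases le_total (l i) (l j) with h | h
    · exact key _ _ h hij
    · exact (key _ _ h hij.symm).symm
  have hv := Matrix.det_vandermonde_ne_zero_iff.2 hinj
  rw [hdet] at hv
  have hM : (Matrix.of fun i j : Fin n => κ ^ (j : ℕ) *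
      (Matrix.of fun i j : Fin n => F ((l i : ℤ) - (j : ℕ))) i j) =
      Matrix.of fun i j : Fin n => F (l i) * (Matrix.of fun i j : Fin n =>
        (∏ t ∈ Finset.range (j : ℕ), (-(w ^ t)⁻¹)) *
          (Matrix.of fun i j => (P j).eval (w ^ l i)) i j) i j := by
    ext i j
    simp only [Matrix.of_apply, hP]
    rw [hstep, Finset.prod_mul_distrib, Polynomial.eval_prod]
    simp
  have hM' := congrArg Matrix.det hM
  rw [Matrix.det_mul_row, Matrix.det_mul_column, Matrix.det_mul_row] at hM'
  intro h0
  rw [h0, mul_zero] at hM'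
  refine mul_ne_zero ?_ (mul_ne_zero ?_ hv) hM'.symm
  · exact Finset.prod_ne_zero_iff.2 fun i _ => hF0 _
  · exact Finset.prod_ne_zero_iff.2 fun i _ => Finset.prod_ne_zero_iff.2 fun t _ =>
      neg_ne_zero.2 (inv_ne_zero (pow_ne_zero _ hw0))

lemma pow_ne_one_of_norm_lt {q : ℂ} (hq : ‖q‖ < 1) (k : ℕ) (hk : k ≠ 0) : q ^ k ≠ 1 := by
  intro h
  have h1 := congrArg norm h
  rw [norm_pow, norm_one] at h1
  exact (pow_lt_one₀ (norm_nonneg q) hq hk).ne h1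

/-- The power series of `1 / (c z; q)_∞`. -/
def eulerInv (q c : ℂ) : PowerSeries ℂ := rescale c (eulerSeries q)⁻¹

lemma constantCoeff_eulerSeries (q : ℂ) : constantCoeff (eulerSeries q) = 1 := by
  have := constantCoeff_euler q 1
  rwa [euler, rescale_one, RingHom.id_apply] at this

lemma euler_mul_eulerInv (q c : ℂ) : euler q c * eulerInv q c = 1 := by
  rw [euler, eulerInv, ← map_mul, PowerSeries.mul_inv_cancel _ (by
    rw [constantCoeff_eulerSeries]; exact one_ne_zero), map_one]

lemma intCoeff_euler_rec {q : ℂ} (hq0 : q ≠ 0) (hq : ‖q‖ < 1) (c : ℂ) (k : ℤ) :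
    (1 - q⁻¹ ^ k) * intCoeff (euler q c) k = c * q⁻¹ * intCoeff (euler q c) (k - 1) := by
  have h := congrFun (congrArg intCoeff (euler_eq hq c)) k
  rw [intCoeff_one_sub_mul, mul_comm c q, ← rescale_euler, intCoeff_rescale] at h
  simp only [backShift] at h
  rw [zpow_sub_one₀ hq0] at h
  rw [inv_zpow]
  have := zpow_ne_zero k hq0
  field_simp at h ⊢
  linear_combination -h

lemma intCoeff_eulerInv_rec {q : ℂ} (hq : ‖q‖ < 1) (c : ℂ) (k : ℤ) :
    (1 - q ^ k) * intCoeff (eulerInv q c) k = c * intCoeff (eulerInv q c) (k - 1) := by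
  have h1 := euler_mul_eulerInv q c
  have h2 := congrArg (rescale q) h1
  have h3 : rescale q (eulerInv q c) = (1 - C c * X) * eulerInv q c := by
    rw [map_mul, map_one, rescale_euler, mul_comm q c] at h2
    refine mul_left_cancel₀ (euler_ne_zero q (c * q)) ?_
    rw [h2, ← mul_assoc, mul_comm (euler q (c * q)), ← euler_eq hq, h1]
  have h := congrFun (congrArg intCoeff h3) k
  rw [intCoeff_one_sub_mul, intCoeff_rescale] at h
  simp only [backShift] at h
  linear_combination -h

lemma constantCoeff_eulerInv (q c : ℂ) : constantCoeff (eulerInv q c) = 1 := by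
  have := congrArg constantCoeff (euler_mul_eulerInv q c)
  simpa [constantCoeff_euler] using this

lemma rescale_eulerInv (q c d : ℂ) : rescale d (eulerInv q c) = eulerInv q (d * c) := by
  rw [eulerInv, eulerInv, rescale_rescale, mul_comm]

lemma pSeries_eq {r : ℂ} (hr : ‖r ^ 4‖ < 1) (b x : ℂ) :
    pSeries r b x = euler (r ^ 4) (r * b) * euler (r ^ 4) (r ^ 3 * b) *
      (eulerInv (r ^ 4) (-(r * x)) * eulerInv (r ^ 4) (-(r ^ 3 * x⁻¹))) := by
  rw [← pSeries_mul hr b x]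
  linear_combination (-pSeries r b x * (euler (r ^ 4) (-(r ^ 3 * x⁻¹)) *
    eulerInv (r ^ 4) (-(r ^ 3 * x⁻¹)))) * euler_mul_eulerInv (r ^ 4) (-(r * x)) -
    pSeries r b x * euler_mul_eulerInv (r ^ 4) (-(r ^ 3 * x⁻¹))

lemma qSeries_eq {r : ℂ} (hr : ‖r ^ 4‖ < 1) (b x : ℂ) :
    qSeries r b x = eulerInv (r ^ 4) (r * b⁻¹) * eulerInv (r ^ 4) (r ^ 3 * b⁻¹) *
      (euler (r ^ 4) (-(r * x)) * euler (r ^ 4) (-(r ^ 3 * x⁻¹))) := by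
  rw [← qSeries_mul hr b x]
  linear_combination (-qSeries r b x * (euler (r ^ 4) (r ^ 3 * b⁻¹) *
    eulerInv (r ^ 4) (r ^ 3 * b⁻¹))) * euler_mul_eulerInv (r ^ 4) (r * b⁻¹) -
    qSeries r b x * euler_mul_eulerInv (r ^ 4) (r ^ 3 * b⁻¹)

/-- All coefficients of the family `P` of power series belong to the algebra `A` of functions. -/
def CoeffsIn (A : Subalgebra ℂ (ℂ → ℂ)) (P : ℂ → PowerSeries ℂ) : Prop :=
  ∀ k, (fun x => coeff k (P x)) ∈ A

lemma CoeffsIn.mul {A : Subalgebra ℂ (ℂ → ℂ)} {P Q : ℂ → PowerSeries ℂ} (hP : CoeffsIn A P)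
    (hQ : CoeffsIn A Q) : CoeffsIn A (fun x => P x * Q x) := by
  intro k
  have : (fun x => coeff k (P x * Q x)) = ∑ i ∈ Finset.HasAntidiagonal.antidiagonal k,
      (fun x => coeff i.1 (P x)) * (fun x => coeff i.2 (Q x)) := by
    funext x
    simp [coeff_mul]
  rw [this]
  exact sum_mem fun i _ => A.mul_mem (hP _) (hQ _)

lemma coeffsIn_rescale {A : Subalgebra ℂ (ℂ → ℂ)} (P : PowerSeries ℂ) {c : ℂ → ℂ} (hc : c ∈ A) :
    CoeffsIn A (fun x => rescale (c x) P) := by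
  intro k
  have : (fun x => coeff k (rescale (c x) P)) = c ^ k * algebraMap ℂ (ℂ → ℂ) (coeff k P) := by
    funext x
    simp [coeff_rescale]
  rw [this]
  exact A.mul_mem (A.pow_mem hc k) (A.algebraMap_mem _)

lemma CoeffsIn.intCoeff {A : Subalgebra ℂ (ℂ → ℂ)} {P : ℂ → PowerSeries ℂ} (hP : CoeffsIn A P)
    (k : ℤ) : (fun x => intCoeff (P x) k) ∈ A := by
  cases k with
  | ofNat k => exact hP k
  | negSucc k => exact A.zero_mem

lemma det_mem {A : Subalgebra ℂ (ℂ → ℂ)} {N : ℕ} {M : ℂ → Matrix (Fin N) (Fin N) ℂ}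
    (hM : ∀ i j, (fun x => M x i j) ∈ A) : (fun x => (M x).det) ∈ A := by
  have : (fun x => (M x).det) = ∑ σ : Equiv.Perm (Fin N),
      ((Equiv.Perm.sign σ : ℤ) • ∏ i, fun x => M x (σ i) i) := by
    funext x
    simp [Matrix.det_apply, Units.smul_def]
  rw [this]
  exact sum_mem fun σ _ => zsmul_mem (A.prod_mem fun i _ => hM _ _) _

/-- The functions which agree with a Laurent polynomial away from `0`. -/
def laurent : Subalgebra ℂ (ℂ → ℂ) where
  carrier := {h | ∃ (P : Polynomial ℂ) (d : ℕ), ∀ x ≠ 0, x ^ d * h x = P.eval x}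
  mul_mem' := by
    rintro f g ⟨P, d, hP⟩ ⟨Q, e, hQ⟩
    refine ⟨P * Q, d + e, fun x hx => ?_⟩
    rw [Polynomial.eval_mul, ← hP x hx, ← hQ x hx, pow_add, Pi.mul_apply]
    ring
  add_mem' := by
    rintro f g ⟨P, d, hP⟩ ⟨Q, e, hQ⟩
    refine ⟨Polynomial.X ^ e * P + Polynomial.X ^ d * Q, d + e, fun x hx => ?_⟩
    simp only [Polynomial.eval_add, Polynomial.eval_mul, Polynomial.eval_pow, Polynomial.eval_X]
    rw [← hP x hx, ← hQ x hx, pow_add, Pi.add_apply]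
    ring
  algebraMap_mem' c := ⟨Polynomial.C c, 0, fun x _ => by simp⟩

lemma id_mem_laurent : (fun x => x) ∈ laurent := ⟨Polynomial.X, 0, fun x _ => by simp⟩

lemma inv_mem_laurent : (fun x => x⁻¹) ∈ laurent := ⟨1, 1, fun x hx => by simp [hx]⟩

lemma const_mem (A : Subalgebra ℂ (ℂ → ℂ)) (c : ℂ) : (fun _ => c) ∈ A := A.algebraMap_mem c

/-- The variable x enters the series only through rescalings by multiples of x and x⁻¹, so each
coefficient is a Laurent polynomial. -/
lemma R_mem_laurent {r : ℂ} (hr : ‖r ^ 4‖ < 1) (b : ℂ) (m n : ℤ) :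
    (fun x => R r b x m n) ∈ laurent := by
  have h1 : (fun x => -(r * x)) ∈ laurent :=
    laurent.neg_mem (laurent.mul_mem (const_mem _ r) id_mem_laurent)
  have h2 : (fun x => -(r ^ 3 * x⁻¹)) ∈ laurent :=
    laurent.neg_mem (laurent.mul_mem (const_mem _ (r ^ 3)) inv_mem_laurent)
  have hc : ∀ P : PowerSeries ℂ, CoeffsIn laurent (fun _ => P) := fun P k => const_mem _ _
  have hp : CoeffsIn laurent (fun x => pSeries r b x) := by
    simp only [pSeries_eq hr]
    exact (hc _).mul ((coeffsIn_rescale _ h1).mul (coeffsIn_rescale _ h2))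
  have hq : CoeffsIn laurent (fun x => qSeries r b x) := by
    simp only [qSeries_eq hr]
    exact (hc _).mul ((coeffsIn_rescale _ h1).mul (coeffsIn_rescale _ h2))
  unfold R
  refine laurent.mul_mem (const_mem _ _) (det_mem fun i j => ?_)
  simp only [RMatrix, Matrix.of_apply]
  split_ifs
  · simp only [qCoeff_eq]
    exact hq.intCoeff _
  · simp only [pCoeff_eq]
    exact hp.intCoeff _

/-- The functions which are continuous. -/
def continuousFun : Subalgebra ℂ (ℂ → ℂ) where
  carrier := {h | Continuous h}
  mul_mem' := fun hf hg => Continuous.mul hf hg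
  add_mem' := fun hf hg => Continuous.add hf hg
  algebraMap_mem' _ := continuous_const

/-- The rescaled series of `pGen`, as a function of `y = x⁻¹`. -/
def pLead (r b y : ℂ) : PowerSeries ℂ :=
  rescale y (euler (r ^ 4) (r * b) * euler (r ^ 4) (r ^ 3 * b)) *
    (eulerInv (r ^ 4) (-r) * rescale (y ^ 2) (eulerInv (r ^ 4) (-r ^ 3)))

/-- The rescaled series of `qGen`, as a function of `y = x⁻¹`. -/
def qLead (r b y : ℂ) : PowerSeries ℂ :=
  rescale y (eulerInv (r ^ 4) (r * b⁻¹) * eulerInv (r ^ 4) (r ^ 3 * b⁻¹)) *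
    (euler (r ^ 4) (-r) * rescale (y ^ 2) (euler (r ^ 4) (-r ^ 3)))

lemma rescale_pSeries {r : ℂ} (hr : ‖r ^ 4‖ < 1) (b : ℂ) {y : ℂ} (hy : y ≠ 0) :
    rescale y (pSeries r b y⁻¹) = pLead r b y := by
  rw [pSeries_eq hr, pLead]
  simp only [map_mul, rescale_eulerInv, rescale_euler, inv_inv]
  congr 3
  · field_simp
  · ring

lemma rescale_qSeries {r : ℂ} (hr : ‖r ^ 4‖ < 1) (b : ℂ) {y : ℂ} (hy : y ≠ 0) :
    rescale y (qSeries r b y⁻¹) = qLead r b y := by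
  rw [qSeries_eq hr, qLead]
  simp only [map_mul, rescale_eulerInv, rescale_euler, inv_inv]
  congr 3
  · field_simp
  · ring

lemma rescale_zero_eq_one {P : PowerSeries ℂ} (h : constantCoeff P = 1) : rescale 0 P = 1 := by
  rw [rescale_zero, RingHom.comp_apply, h, map_one]

lemma pLead_zero (r b : ℂ) : pLead r b 0 = eulerInv (r ^ 4) (-r) := by
  rw [pLead, zero_pow two_ne_zero, rescale_zero_eq_one, rescale_zero_eq_one, one_mul, mul_one]
  · exact constantCoeff_eulerInv _ _
  · rw [map_mul, constantCoeff_euler, constantCoeff_euler, one_mul]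

lemma qLead_zero (r b : ℂ) : qLead r b 0 = euler (r ^ 4) (-r) := by
  rw [qLead, zero_pow two_ne_zero, rescale_zero_eq_one, rescale_zero_eq_one, one_mul, mul_one]
  · exact constantCoeff_euler _ _
  · rw [map_mul, constantCoeff_eulerInv, constantCoeff_eulerInv, one_mul]

/-- The matrix `RMatrix` with rows and columns rescaled so as to converge for `x → ∞`, as a
function of `y = x⁻¹`. -/
def leadMatrix (r b : ℂ) (m n : ℕ) (y : ℂ) : Matrix (Fin (m + n)) (Fin (m + n)) ℂ :=
  Matrix.of fun i j =>
    (if (i : ℕ) < m then intCoeff (qLead r b y) (2 * (i : ℤ) + 1 - (j : ℤ))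
      else intCoeff (pLead r b y) ((n : ℤ) + (m : ℤ) - 2 * (i : ℤ) + (j : ℤ))) *
    -- These powers of y are what remains after the row and column scalings of `det_leadMatrix`.
    -- They are nonnegative everywhere and positive in the upper right block.
    (if (i : ℕ) < m then (if (j : ℕ) < m then 1 else y ^ (2 * (j + 1 - m : ℕ)))
      else (if (j : ℕ) < m then y ^ (2 * (m - 1 - j : ℕ)) else 1))

lemma continuous_det_leadMatrix (r b : ℂ) (m n : ℕ) :
    Continuous fun y => (leadMatrix r b m n y).det := by
  have hid : (fun y => y) ∈ continuousFun := continuous_id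
  have hsq : (fun y : ℂ => y ^ 2) ∈ continuousFun := continuous_pow 2
  have hc : ∀ P : PowerSeries ℂ, CoeffsIn continuousFun (fun _ => P) := fun P k => const_mem _ _
  have hp : CoeffsIn continuousFun (fun y => pLead r b y) :=
    (coeffsIn_rescale _ hid).mul ((hc _).mul (coeffsIn_rescale _ hsq))
  have hq : CoeffsIn continuousFun (fun y => qLead r b y) :=
    (coeffsIn_rescale _ hid).mul ((hc _).mul (coeffsIn_rescale _ hsq))
  refine det_mem (A := continuousFun) fun i j => ?_
  simp only [leadMatrix, Matrix.of_apply]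
  refine continuousFun.mul_mem ?_ ?_
  · split_ifs
    · exact hq.intCoeff _
    · exact hp.intCoeff _
  · split_ifs
    · exact const_mem _ _
    · exact continuous_pow _
    · exact continuous_pow _
    · exact const_mem _ _

/-- At y = 0 the matrix is block lower triangular. The diagonal blocks are built from the
coefficients of (-q^{1/4}t;q)_∞ and of its inverse, which satisfy the recursion of `det_sub_ne_zero`
with w = q⁻¹ and w = q. -/
lemma det_leadMatrix_zero_ne_zero {r : ℂ} (hr0 : r ≠ 0) (hr : ‖r ^ 4‖ < 1) (b : ℂ) (m n : ℕ) :
    (leadMatrix r b m n 0).det ≠ 0 := by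
  have hq0 : r ^ 4 ≠ 0 := pow_ne_zero 4 hr0
  rw [← Matrix.det_submatrix_equiv_self finSumFinEquiv, ← Matrix.fromBlocks_toBlocks
    ((leadMatrix r b m n 0).submatrix finSumFinEquiv finSumFinEquiv)]
  have h12 : ((leadMatrix r b m n 0).submatrix finSumFinEquiv finSumFinEquiv).toBlocks₁₂ = 0 := by
    ext i j
    have : m + (j : ℕ) + 1 - m ≠ 0 := by omega
    simp [Matrix.toBlocks₁₂, leadMatrix, this]
  rw [h12, Matrix.det_fromBlocks_zero₁₂]
  refine mul_ne_zero ?_ ?_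
  · have h := det_sub_ne_zero (inv_ne_zero hq0) (w := (r ^ 4)⁻¹) (κ := -r * (r ^ 4)⁻¹)
      (fun k hk h => pow_ne_one_of_norm_lt hr k hk (by rwa [inv_pow, inv_eq_one] at h))
      (mul_ne_zero (neg_ne_zero.2 hr0) (inv_ne_zero hq0))
      (isUnital_intCoeff (constantCoeff_euler (r ^ 4) (-r)))
      (intCoeff_euler_rec hq0 hr (-r)) (fun i : Fin m => 2 * (i : ℕ) + 1)
      (fun i j hij => by ext; simpa using hij)
    convert h using 2
    ext i j
    simp [Matrix.toBlocks₁₁, leadMatrix, qLead_zero]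
  · have h := det_sub_ne_zero hq0 (pow_ne_one_of_norm_lt hr) (neg_ne_zero.2 hr0)
      (isUnital_intCoeff (constantCoeff_eulerInv (r ^ 4) (-r)))
      (intCoeff_eulerInv_rec hr (-r)) (fun i : Fin n => 2 * (i : ℕ) + 1)
      (fun i j hij => by ext; simpa using hij)
    -- Reversing rows and columns brings the entries of the p-block to the form F(2i + 1 - j).
    rw [← Matrix.det_submatrix_equiv_self Fin.revPerm]
    convert h using 2
    ext i j
    simp only [Matrix.toBlocks₂₂, leadMatrix, pLead_zero, Matrix.submatrix_apply, Matrix.of_apply,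
      finSumFinEquiv_apply_right, Fin.val_natAdd, Fin.revPerm_apply, Fin.val_rev]
    rw [if_neg (by omega), if_neg (by omega), if_neg (by omega), mul_one]
    congr 1
    push_cast [Nat.cast_sub (Nat.succ_le_of_lt i.2), Nat.cast_sub (Nat.succ_le_of_lt j.2)]
    ring

lemma det_leadMatrix {r : ℂ} (hr : ‖r ^ 4‖ < 1) (b : ℂ) (m n : ℕ) {y : ℂ} (hy : y ≠ 0) :
    ∃ c : ℂ, (leadMatrix r b m n y).det = c * (RMatrix r b y⁻¹ m n).det := by
  set u : Fin (m + n) → ℂ := fun i => y ^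
    (if (i : ℕ) < m then 2 * (i : ℤ) + 1 else (n : ℤ) + 3 * m - 2 * i - 2) with hu
  set v : Fin (m + n) → ℂ := fun j => y ^
    (if (j : ℕ) < m then -(j : ℤ) else (j : ℤ) + 2 - 2 * m) with hv
  refine ⟨(∏ i, u i) * ∏ j, v j, ?_⟩
  rw [mul_assoc, ← Matrix.det_mul_row, ← Matrix.det_mul_column]
  congr 1
  ext i j
  simp only [leadMatrix, RMatrix, Matrix.of_apply, hu, hv, ← rescale_pSeries hr b hy,
    ← rescale_qSeries hr b hy, intCoeff_rescale, ← pCoeff_eq, ← qCoeff_eq]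
  by_cases hi : (i : ℕ) < m <;> by_cases hj : (j : ℕ) < m
  · simp only [hi, hj, if_true, mul_one]
    rw [← mul_assoc, ← zpow_add₀ hy]
    ring_nf
  · simp only [hi, hj, if_true, if_false]
    rw [← mul_assoc, ← zpow_add₀ hy, mul_right_comm, ← zpow_natCast, ← zpow_add₀ hy]
    congr 2
    push_cast [Nat.cast_sub (show m ≤ (j : ℕ) + 1 by omega)]
    ring
  · simp only [hi, hj, if_true, if_false]
    rw [← mul_assoc, ← zpow_add₀ hy, mul_right_comm, ← zpow_natCast, ← zpow_add₀ hy]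
    congr 2
    rw [show m - 1 - (j : ℕ) = m - (j + 1) by omega]
    push_cast [Nat.cast_sub (show (j : ℕ) + 1 ≤ m by omega)]
    ring
  · simp only [hi, hj, if_false, mul_one]
    rw [← mul_assoc, ← zpow_add₀ hy]
    congr 2
    ring

/-- The functions `R_{m,n}` do not vanish identically. -/
lemma exists_R_ne_zero {r : ℂ} (hr0 : r ≠ 0) (hr : ‖r ^ 4‖ < 1) (b : ℂ) (m n : ℤ) :
    ∃ x ≠ 0, R r b x m n ≠ 0 := by
  by_contra! h
  have hdet : ∀ y : ℂ, y ≠ 0 → (leadMatrix r b (reflIndex m) (reflIndex n) y).det = 0 := by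
    intro y hy
    obtain ⟨c, hc⟩ := det_leadMatrix hr b (reflIndex m) (reflIndex n) hy
    have h0 := h y⁻¹ (inv_ne_zero hy)
    have hs : ∀ k : ℤ, reflSign k ≠ 0 := by
      intro k
      cases k <;> simp [reflSign]
    unfold R at h0
    rw [hc, (mul_eq_zero.1 h0).resolve_left (mul_ne_zero (hs m) (hs n)), mul_zero]
  refine det_leadMatrix_zero_ne_zero hr0 hr b (reflIndex m) (reflIndex n) ?_
  -- If R vanished identically, continuity would carry the zero of the determinant from y ≠ 0 to y =
  -- 0.
  have hcl : IsClosed {y : ℂ | (leadMatrix r b (reflIndex m) (reflIndex n) y).det = 0} :=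
    isClosed_eq (continuous_det_leadMatrix _ _ _ _) continuous_const
  have hsub : ({0}ᶜ : Set ℂ) ⊆ {y : ℂ | (leadMatrix r b (reflIndex m) (reflIndex n) y).det = 0} :=
    fun y hy => hdet y hy
  have := hcl.closure_subset_iff.2 hsub
  rw [(dense_compl_singleton (0 : ℂ)).closure_eq] at this
  exact this (Set.mem_univ 0)

/-- Each `R_{m,n}` is a nonzero polynomial in `x` divided by a power of `x`. -/
lemma exists_polynomial_R {r : ℂ} (hr0 : r ≠ 0) (hr : ‖r ^ 4‖ < 1) (b : ℂ) (m n : ℤ) :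
    ∃ (P : Polynomial ℂ) (d : ℕ), P ≠ 0 ∧ ∀ x ≠ 0, x ^ d * R r b x m n = P.eval x := by
  obtain ⟨P, d, hP⟩ := R_mem_laurent hr b m n
  refine ⟨P, d, ?_, hP⟩
  rintro rfl
  obtain ⟨x, hx, hne⟩ := exists_R_ne_zero hr0 hr b m n
  have := hP x hx
  rw [Polynomial.eval_zero] at this
  exact mul_ne_zero (pow_ne_zero d hx) hne this

lemma finite_zeros_R {r : ℂ} (hr0 : r ≠ 0) (hr : ‖r ^ 4‖ < 1) (b : ℂ) (m n : ℤ) :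
    {x : ℂ | x ≠ 0 ∧ R r b x m n = 0}.Finite := by
  obtain ⟨P, d, hP0, hP⟩ := exists_polynomial_R hr0 hr b m n
  refine (Polynomial.finite_setOfPred_isRoot hP0).subset ?_
  rintro x ⟨hx, h0⟩
  have := hP x hx
  rw [h0, mul_zero] at this
  exact this.symm

end Leading
end QPainleveV
end

noncomputable section

namespace QPainleveV

/-! ### Rational functions and their values off finite sets -/

section RationalFunctions

open Filter Polynomial

lemma eventually_eval_ne_zero {P : Polynomial ℂ} (hP : P ≠ 0) :
    ∀ᶠ x in cofinite, P.eval x ≠ 0 := by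
  have := Polynomial.finite_setOfPred_isRoot hP
  simpa [Filter.eventually_cofinite, Polynomial.IsRoot] using this

/-- `RatFunc.eval` uses the reduced fraction; its denominator divides Q and so does not vanish at x.
-/
lemma eval_ratFunc_div {P Q : Polynomial ℂ} {x : ℂ} (hQ : Q.eval x ≠ 0) :
    (algebraMap _ (RatFunc ℂ) P / algebraMap _ (RatFunc ℂ) Q).eval (RingHom.id ℂ) x =
      P.eval x / Q.eval x := by
  have hQ0 : Q ≠ 0 := by
    rintro rfl
    simp at hQ
  set f : RatFunc ℂ := algebraMap _ (RatFunc ℂ) P / algebraMap _ (RatFunc ℂ) Q with hf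
  have h := congrArg (Polynomial.eval x) ((RatFunc.num_mul_eq_mul_denom_iff hQ0).2 hf)
  rw [Polynomial.eval_mul, Polynomial.eval_mul] at h
  have hd : f.denom.eval x ≠ 0 := by
    obtain ⟨c, hc⟩ := RatFunc.denom_div_dvd P Q
    rw [← hf] at hc
    intro h0
    rw [hc, Polynomial.eval_mul, h0, zero_mul] at hQ
    exact hQ rfl
  rw [RatFunc.eval, Polynomial.eval₂_id, Polynomial.eval₂_id, div_eq_div_iff hd hQ, h]

/-- A quotient of Laurent polynomials is a rational function. -/
lemma exists_ratFunc {g h : ℂ → ℂ} (hg : g ∈ laurent) (hh : h ∈ laurent) :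
    ∃ f : RatFunc ℂ, ∀ x ≠ 0, h x ≠ 0 → f.eval (RingHom.id ℂ) x = g x / h x := by
  obtain ⟨P, d, hP⟩ := hg
  obtain ⟨Q, e, hQ⟩ := hh
  refine ⟨algebraMap _ _ (P * X ^ e) / algebraMap _ _ (Q * X ^ d), fun x hx hx' => ?_⟩
  have hd := pow_ne_zero d hx
  have he := pow_ne_zero e hx
  rw [eval_ratFunc_div]
  · simp only [eval_mul, eval_pow, eval_X, ← hP x hx, ← hQ x hx]
    field_simp
  · simp only [eval_mul, eval_pow, eval_X, ← hQ x hx]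
    exact mul_ne_zero (mul_ne_zero he hx') hd

lemma comp_mul_mem_laurent {g : ℂ → ℂ} (hg : g ∈ laurent) {c : ℂ} (hc : c ≠ 0) :
    (fun x => g (c * x)) ∈ laurent := by
  obtain ⟨P, d, hP⟩ := hg
  refine ⟨C (c ^ d)⁻¹ * P.comp (C c * X), d, fun x hx => ?_⟩
  have h := hP (c * x) (mul_ne_zero hc hx)
  rw [eval_mul, eval_C, eval_comp, eval_mul, eval_C, eval_X, ← h, mul_pow]
  have := pow_ne_zero d hc
  field_simp

/-- The rational function `f` takes the values `g x` outside a finite set. -/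
def Represents (f : RatFunc ℂ) (g : ℂ → ℂ) : Prop :=
  ∀ᶠ x in cofinite, f.eval (RingHom.id ℂ) x = g x

lemma eventually_denom_ne_zero (f : RatFunc ℂ) :
    ∀ᶠ x in cofinite, f.denom.eval₂ (RingHom.id ℂ) x ≠ 0 := by
  simpa only [Polynomial.eval₂_id] using eventually_eval_ne_zero f.denom_ne_zero

lemma represents_C (c : ℂ) : Represents (RatFunc.C c) (fun _ => c) :=
  .of_forall fun x => by simp [RatFunc.eval_C]

lemma represents_one : Represents 1 (fun _ => 1) :=
  .of_forall fun x => by simp [RatFunc.eval_one]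

lemma represents_X : Represents RatFunc.X (fun x => x) :=
  .of_forall fun x => by simp [RatFunc.eval_X]

namespace Represents

variable {f f' : RatFunc ℂ} {g g' : ℂ → ℂ}

lemma add (h : Represents f g) (h' : Represents f' g') :
    Represents (f + f') (fun x => g x + g' x) := by
  filter_upwards [h, h', eventually_denom_ne_zero f, eventually_denom_ne_zero f'] with x h1 h2 h3 h4
  rw [RatFunc.eval_add _ _ h3 h4, h1, h2]

lemma mul (h : Represents f g) (h' : Represents f' g') :
    Represents (f * f') (fun x => g x * g' x) := by
  filter_upwards [h, h', eventually_denom_ne_zero f, eventually_denom_ne_zero f'] with x h1 h2 h3 h4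
  rw [RatFunc.eval_mul _ _ h3 h4, h1, h2]

lemma inv (h : Represents f g) : Represents f⁻¹ (fun x => (g x)⁻¹) := by
  -- For f = 0 both sides take the default value 0⁻¹ = 0.
  rcases eq_or_ne f 0 with rfl | hf
  · rw [inv_zero]
    filter_upwards [h] with x hx
    rw [RatFunc.eval_zero] at hx
    rw [RatFunc.eval_zero, ← hx, inv_zero]
  · filter_upwards [h, eventually_denom_ne_zero f, eventually_denom_ne_zero f⁻¹] with x h1 h2 h3
    have h4 := RatFunc.eval_mul _ _ h2 h3
    rw [mul_inv_cancel₀ hf, RatFunc.eval_one, h1] at h4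
    exact eq_inv_of_mul_eq_one_right h4.symm

lemma div (h : Represents f g) (h' : Represents f' g') :
    Represents (f / f') (fun x => g x / g' x) := by
  simpa only [div_eq_mul_inv] using h.mul h'.inv

/-- The cross-multiplied difference of the fractions is a polynomial vanishing off a finite set,
hence zero. -/
lemma ext (h : Represents f g) (h' : Represents f' g') (hg : ∀ᶠ x in cofinite, g x = g' x) :
    f = f' := by
  have hz : ∀ᶠ x in cofinite, (f.num * f'.denom - f'.num * f.denom).eval x = 0 := by
    filter_upwards [h, h', hg, eventually_denom_ne_zero f, eventually_denom_ne_zero f']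
      with x h1 h2 h3 h4 h5
    rw [h3, ← h2, RatFunc.eval, RatFunc.eval, div_eq_div_iff h4 h5] at h1
    simp only [eval₂_id] at h1
    rw [eval_sub, eval_mul, eval_mul, h1, sub_self]
  have hpoly : f.num * f'.denom - f'.num * f.denom = 0 := by
    by_contra hne
    obtain ⟨x, hx1, hx2⟩ := (hz.and (eventually_eval_ne_zero hne)).exists
    exact hx2 hx1
  rw [← RatFunc.num_div_denom f', ← RatFunc.num_mul_eq_mul_denom_iff f'.denom_ne_zero]
  exact sub_eq_zero.1 hpoly

lemma ne_zero (h : Represents f g) (hg : ∀ᶠ x in cofinite, g x ≠ 0) : f ≠ 0 := by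
  rintro rfl
  obtain ⟨x, h1, h2⟩ := (h.and hg).exists
  rw [RatFunc.eval_zero] at h1
  exact h2 h1.symm

lemma evolDen {a f : Fin 4 → RatFunc ℂ} {α : Fin 4 → ℂ} {φ : Fin 4 → ℂ → ℂ}
    (ha : ∀ i, a i = RatFunc.C (α i)) (hf : ∀ i, Represents (f i) (φ i)) (i : Fin 4) :
    Represents (evolDen a f i) (fun x => QPainleveV.evolDen α (fun j => φ j x) i) := by
  have ha' : ∀ j, Represents (a j) (fun _ => α j) := fun j => by
    rw [ha j]
    exact represents_C _
  unfold QPainleveV.evolDen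
  exact ((represents_one.add ((ha' _).mul (hf _))).add
    ((((ha' _).mul (ha' _)).mul (hf _)).mul (hf _))).add
    ((((((ha' _).mul (ha' _)).mul (ha' _)).mul (hf _)).mul (hf _)).mul (hf _))

lemma dilate (h : Represents f g) {s : ℂ} (hs : s ≠ 0) :
    Represents (dilate s f) (fun x => g (s * x)) := by
  have hpoly : ∀ P : Polynomial ℂ, P.eval₂ RatFunc.C (RatFunc.C s * RatFunc.X) =
      algebraMap _ (RatFunc ℂ) (P.comp (C s * X)) := by
    intro P
    rw [Polynomial.comp, Polynomial.hom_eval₂, RatFunc.algebraMap_comp_C, map_mul,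
      RatFunc.algebraMap_C, RatFunc.algebraMap_X]
  have hinj : Function.Injective fun x : ℂ => s * x := mul_right_injective₀ hs
  have hev : ∀ {p : ℂ → Prop}, (∀ᶠ x in cofinite, p x) → ∀ᶠ x in cofinite, p (s * x) :=
    fun hp => hinj.tendsto_cofinite.eventually hp
  filter_upwards [hev h, hev (eventually_denom_ne_zero f)] with x h1 h2
  have hdil : QPainleveV.dilate s f = algebraMap _ (RatFunc ℂ) (f.num.comp (C s * X)) /
      algebraMap _ (RatFunc ℂ) (f.denom.comp (C s * X)) := by
    rw [QPainleveV.dilate, RatFunc.eval, hpoly, hpoly]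
  rw [← h1, hdil, eval_ratFunc_div]
  · simp [RatFunc.eval, Polynomial.eval₂_id]
  · simpa [Polynomial.eval₂_id] using h2

end Represents

lemma dilate_C (s c : ℂ) : dilate s (RatFunc.C c) = RatFunc.C c := by
  rw [dilate, RatFunc.eval_C]

end RationalFunctions
end QPainleveV
end

/-! ### The four tau functions and the data of the eight formulas -/

noncomputable section

namespace QPainleveV

lemma S_eq_R {r b a : ℂ} {m n : ℤ} (h : (r ^ 2) ^ (-(m - n)) * a = b) (x : ℂ) :
    S r m n x a = R r b x m n := by
  rw [← h, S]

/-- The four functions whose ratios are the `f_i`. -/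
def stairTau (r : ℂ) (m n : ℤ) (a : ℂ) : Fin 4 → ℂ → ℂ :=
  ![fun x => S r m n x a, fun x => S r (m - 1) n x ((r ^ 4)⁻¹ * a),
    fun x => S r (m - 1) (n - 1) x a, fun x => S r m (n - 1) x a]

/-- The images of the functions `stairTau` under the simple reflections. -/
def stairNext (r : ℂ) (m n : ℤ) (a : ℂ) : Fin 4 → ℂ → ℂ :=
  ![fun x => S r (m - 1) (n - 1) x ((r ^ 4)⁻¹ * a), fun x => S r m (n - 1) x (r ^ 4 * a),
    fun x => S r m n x ((r ^ 4)⁻¹ * a), fun x => S r (m - 1) n x a]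

/-- The parameters `a_i`. -/
def param (r : ℂ) (m n : ℤ) (a : ℂ) : Fin 4 → ℂ :=
  ![(r ^ 2) ^ (2 * n - 1) * a, a⁻¹, (r ^ 2) ^ (-(2 * m + 1)) * a, (r ^ 4) ^ (m - n) * a⁻¹]

/-- The constants in the formulas for `1 + a_i f_i`. -/
def coefUp (r : ℂ) (m n : ℤ) : Fin 4 → ℂ :=
  ![(r ^ 2) ^ m, (r ^ 2) ^ n, (r ^ 2) ^ (-m), (r ^ 2) ^ (-n)]

/-- The constants in the linear factors of the formulas for `1 + a_i f_i`. -/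
def rootUp (r : ℂ) (m n : ℤ) (a : ℂ) : Fin 4 → ℂ :=
  ![(r ^ 2) ^ (-(m - n + 1)) * a, (r ^ 2) ^ (m - n) * a⁻¹, (r ^ 2) ^ (-(m - n + 1)) * a,
    (r ^ 2) ^ (m - n) * a⁻¹]

/-- The constants in the formulas for `1 + a_i⁻¹ f_i`. -/
def coefDown (r : ℂ) (m n : ℤ) : Fin 4 → ℂ :=
  ![(r ^ 2) ^ (-n), (r ^ 2) ^ m, (r ^ 2) ^ n, (r ^ 2) ^ (-m)]

/-- The constants in the linear factors of the formulas for `1 + a_i⁻¹ f_i`. -/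
def rootDown (r : ℂ) (m n : ℤ) (a : ℂ) : Fin 4 → ℂ :=
  ![(r ^ 2) ^ (m - n + 1) * a⁻¹, (r ^ 2) ^ (-(m - n)) * a, (r ^ 2) ^ (m - n + 1) * a⁻¹,
    (r ^ 2) ^ (-(m - n)) * a]

/-- The inverse parameters `a_i⁻¹`. -/
def paramDown (r : ℂ) (m n : ℤ) (a : ℂ) : Fin 4 → ℂ :=
  ![(r ^ 2) ^ (-(2 * n - 1)) * a⁻¹, a, (r ^ 2) ^ (2 * m + 1) * a⁻¹, (r ^ 4) ^ (-m + n) * a]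

/-- The constants in the formulas for the denominators of the time evolution. -/
def coefToda (r : ℂ) (m n : ℤ) : Fin 4 → ℂ :=
  ![(r ^ 2) ^ n, (r ^ 2) ^ (-m), (r ^ 2) ^ (-n), (r ^ 2) ^ m]

/-- The function whose rational function is `f_i`. -/
def stairRatio (r : ℂ) (m n : ℤ) (a : ℂ) (i : Fin 4) (x : ℂ) : ℂ :=
  x⁻¹ * (stairTau r m n a (i + 1) (r ^ 2 * x) * stairTau r m n a (i + 3) x /
    (stairTau r m n a (i + 3) (r ^ 2 * x) * stairTau r m n a (i + 1) x))

/-- With b = q^{-(m-n)/2}a, the τ_i have parameter b for even i and q^{-1/2}b for odd i; their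
reflections have q⁻¹b and q^{1/2}b. These are the shifts that occur in the bilinear relations at b
and at q^{1/2}b. -/
lemma stairTau_eq {r : ℂ} (m n : ℤ) (a : ℂ) (hr0 : r ≠ 0) (x : ℂ) :
    (stairTau r m n a 0 x = R r ((r ^ 2) ^ (-(m - n)) * a) x m n ∧
    stairTau r m n a 1 x = R r ((r ^ 2)⁻¹ * ((r ^ 2) ^ (-(m - n)) * a)) x (m - 1) n ∧
    stairTau r m n a 2 x = R r ((r ^ 2) ^ (-(m - n)) * a) x (m - 1) (n - 1) ∧
    stairTau r m n a 3 x = R r ((r ^ 2)⁻¹ * ((r ^ 2) ^ (-(m - n)) * a)) x m (n - 1)) ∧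
    (stairNext r m n a 0 x =
      R r ((r ^ 2)⁻¹ * ((r ^ 2)⁻¹ * ((r ^ 2) ^ (-(m - n)) * a))) x (m - 1) (n - 1) ∧
    stairNext r m n a 1 x = R r (r ^ 2 * ((r ^ 2) ^ (-(m - n)) * a)) x m (n - 1) ∧
    stairNext r m n a 2 x = R r ((r ^ 2)⁻¹ * ((r ^ 2)⁻¹ * ((r ^ 2) ^ (-(m - n)) * a))) x m n ∧
    stairNext r m n a 3 x = R r (r ^ 2 * ((r ^ 2) ^ (-(m - n)) * a)) x (m - 1) n) := by
  have hr2 : r ^ 2 ≠ 0 := pow_ne_zero 2 hr0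
  have h4 : r ^ 4 = r ^ 2 * r ^ 2 := by ring
  refine ⟨⟨S_eq_R rfl x, S_eq_R ?_ x, S_eq_R ?_ x, S_eq_R ?_ x⟩,
    ⟨S_eq_R ?_ x, S_eq_R ?_ x, S_eq_R ?_ x, S_eq_R ?_ x⟩⟩
  · rw [show -(m - 1 - n) = -(m - n) + 1 by ring, zpow_add₀ hr2, h4]
    field_simp
  · rw [show -(m - 1 - (n - 1)) = -(m - n) by ring]
  · rw [show -(m - (n - 1)) = -(m - n) - 1 by ring, zpow_sub₀ hr2]
    field_simp
  · rw [show -(m - 1 - (n - 1)) = -(m - n) by ring, h4]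
    field_simp
  · rw [show -(m - (n - 1)) = -(m - n) - 1 by ring, zpow_sub₀ hr2, h4]
    field_simp
  · rw [h4]
    field_simp
  · rw [show -(m - 1 - n) = -(m - n) + 1 by ring, zpow_add₀ hr2]
    field_simp

lemma one_add_mul_div_eq {A e e' β β' x D N α κ : ℂ} (he : e ≠ 0) (hD : D ≠ 0)
    (h : (1 + β * x⁻¹) * A = e * D + β * x⁻¹ * e' * N) (hκ : κ = e⁻¹) (hα : α = β * e' * e⁻¹)
    (hβ : β' = β) :
    1 + α * (x⁻¹ * (N / D)) = κ * (1 + β' * x⁻¹) * (A / D) := by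
  subst hκ hα hβ
  have h2 : 1 + β' * e' * e⁻¹ * (x⁻¹ * (N / D)) = e⁻¹ * (e * D + β' * x⁻¹ * e' * N) / D := by
    field_simp
  rw [h2, ← h]
  ring

lemma add_eq_of_scaled {P Q W e κ κ' α δ ξ σ : ℂ}
    (h : P + σ * ξ * e ^ 2 * Q = (1 + σ * ξ) * e * W) (hδ : δ = κ * e)
    (hα : α * κ' = κ * e ^ 2 * σ) :
    κ * P + α * κ' * ξ * Q = δ * (1 + σ * ξ) * W := by
  subst hδ
  linear_combination κ * h + ξ * Q * hα

lemma zpow_expand {r : ℂ} (m n : ℤ) (hr0 : r ≠ 0) :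
    ((r ^ 2) ^ (2 * n - 1) = (r ^ 2) ^ n * (r ^ 2) ^ n * (r ^ 2)⁻¹ ∧
    (r ^ 2) ^ (-(2 * n - 1)) = ((r ^ 2) ^ n)⁻¹ * ((r ^ 2) ^ n)⁻¹ * r ^ 2 ∧
    (r ^ 2) ^ (2 * m + 1) = (r ^ 2) ^ m * (r ^ 2) ^ m * r ^ 2 ∧
    (r ^ 2) ^ (-(2 * m + 1)) = ((r ^ 2) ^ m)⁻¹ * ((r ^ 2) ^ m)⁻¹ * (r ^ 2)⁻¹) ∧
    ((r ^ 2) ^ (m - n) = (r ^ 2) ^ m * ((r ^ 2) ^ n)⁻¹ ∧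
    (r ^ 2) ^ (-(m - n)) = ((r ^ 2) ^ m)⁻¹ * (r ^ 2) ^ n ∧
    (r ^ 2) ^ (m - n + 1) = (r ^ 2) ^ m * ((r ^ 2) ^ n)⁻¹ * r ^ 2 ∧
    (r ^ 2) ^ (-(m - n + 1)) = ((r ^ 2) ^ m)⁻¹ * (r ^ 2) ^ n * (r ^ 2)⁻¹) ∧
    ((r ^ 2) ^ (-m) = ((r ^ 2) ^ m)⁻¹ ∧ (r ^ 2) ^ (-n) = ((r ^ 2) ^ n)⁻¹ ∧
    (r ^ 4) ^ (m - n) = ((r ^ 2) ^ m * ((r ^ 2) ^ n)⁻¹) ^ 2 ∧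
    (r ^ 4) ^ (-m + n) = (((r ^ 2) ^ m)⁻¹ * (r ^ 2) ^ n) ^ 2) := by
  have hr2 : r ^ 2 ≠ 0 := pow_ne_zero 2 hr0
  simp only [show r ^ 4 = r ^ 2 * r ^ 2 by ring, mul_zpow]
  generalize r ^ 2 = s at *
  refine ⟨⟨?_, ?_, ?_, ?_⟩, ⟨?_, ?_, ?_, ?_⟩, ⟨?_, ?_, ?_, ?_⟩⟩ <;>
  simp only [zpow_sub₀ hr2, zpow_add₀ hr2, zpow_neg, zpow_one, two_mul] <;> field_simp

lemma zpow_weight_sub (r : ℂ) (k : ℤ) :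
    r ^ (k * (k + 1) - (k - 1) * (k - 1 + 1)) = (r ^ 2) ^ k ∧
    r ^ ((k - 1) * (k - 1 + 1) - k * (k + 1)) = ((r ^ 2) ^ k)⁻¹ := by
  rw [← zpow_neg, ← zpow_natCast, ← zpow_mul, ← zpow_mul]
  constructor <;> congr 1 <;> push_cast <;> ring

/-! ### From bilinear relations to the formulas for f_i and D_i -/

section Formulas

variable {r : ℂ} (hr0 : r ≠ 0) (hr : ‖r ^ 4‖ < 1) (m n : ℤ) {a : ℂ} (ha : a ≠ 0) {x : ℂ}
  (hx : x ≠ 0)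
include hr0 hr ha hx

/-- For even i, τ_i has the unshifted and `stairNext` the doubly shifted parameter of a bilinear
relation at b. For odd i it is the reverse, at q^{1/2}b, which exchanges `R_bilinear_up` and
`R_bilinear_down`. The four values of i correspond to the four directions of the steps in m and n.
-/
lemma stairTau_up (i : Fin 4)
    (hD : stairTau r m n a (i + 3) (r ^ 2 * x) * stairTau r m n a (i + 1) x ≠ 0) :
    1 + param r m n a i * stairRatio r m n a i x =
      coefUp r m n i * (1 + rootUp r m n a i * x⁻¹) *
        (stairTau r m n a i x * stairNext r m n a i (r ^ 2 * x) /
        (stairTau r m n a (i + 3) (r ^ 2 * x) * stairTau r m n a (i + 1) x)) := by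
  obtain ⟨⟨t0, t1, t2, t3⟩, u0, u1, u2, u3⟩ := stairTau_eq m n a hr0 x
  obtain ⟨⟨t0', t1', t2', t3'⟩, u0', u1', u2', u3'⟩ := stairTau_eq m n a hr0 (r ^ 2 * x)
  have hr2 : r ^ 2 ≠ 0 := pow_ne_zero 2 hr0
  have hb : (r ^ 2) ^ (-(m - n)) * a ≠ 0 := mul_ne_zero (zpow_ne_zero _ hr2) ha
  have hb' : r ^ 2 * ((r ^ 2) ^ (-(m - n)) * a) ≠ 0 := mul_ne_zero hr2 hb
  obtain ⟨⟨z1, z2, z3, z4⟩, ⟨z5, z6, z7, z8⟩, z9, z10, z11, z12⟩ := zpow_expand m n hr0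
  obtain ⟨em, em'⟩ := zpow_weight_sub r m
  obtain ⟨en, en'⟩ := zpow_weight_sub r n
  have hM : (r ^ 2) ^ m ≠ 0 := zpow_ne_zero _ hr2
  have hN : (r ^ 2) ^ n ≠ 0 := zpow_ne_zero _ hr2
  match i with
  | 0 =>
    have h := R_bilinear_up hr0 hr hb hx (isAdj_sub_one m) (isAdj_sub_one n)
    rw [em', en] at h
    refine one_add_mul_div_eq (e := ((r ^ 2) ^ m)⁻¹) (e' := (r ^ 2) ^ n)
      (β := (r ^ 2)⁻¹ * ((r ^ 2) ^ (-(m - n)) * a)) (inv_ne_zero hM) hD ?_ ?_ ?_ ?_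
    · simp only [Fin.reduceAdd, t0, t1, t3, t1', t3', u0']
      linear_combination h
    · simp [coefUp]
    · simp only [param, Matrix.cons_val]
      simp only [z1, z6]
      field_simp
    · simp only [rootUp, Matrix.cons_val]
      simp only [z6, z8]
      field_simp
  | 1 =>
    have h := R_bilinear_down hr0 hr hb' hx (isAdj_sub_one m) (isAdj_sub_one' n)
    rw [en', em'] at h
    refine one_add_mul_div_eq (e := ((r ^ 2) ^ n)⁻¹) (e' := ((r ^ 2) ^ m)⁻¹)
      (β := r ^ 2 * (r ^ 2 * ((r ^ 2) ^ (-(m - n)) * a))⁻¹) (inv_ne_zero hN) hD ?_ ?_ ?_ ?_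
    · simp only [inv_mul_cancel_left₀ hr2] at h
      simp only [Fin.reduceAdd, t0, t1, t2, t0', t2', u1']
      linear_combination h
    · simp [coefUp]
    · simp only [param, Matrix.cons_val]
      simp only [z6]
      field_simp
    · simp only [rootUp, Matrix.cons_val]
      simp only [z5, z6]
      field_simp
  | 2 =>
    have h := R_bilinear_up hr0 hr hb hx (isAdj_sub_one' m) (isAdj_sub_one' n)
    rw [em, en'] at h
    refine one_add_mul_div_eq (e := (r ^ 2) ^ m) (e' := ((r ^ 2) ^ n)⁻¹)
      (β := (r ^ 2)⁻¹ * ((r ^ 2) ^ (-(m - n)) * a)) hM hD ?_ ?_ ?_ ?_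
    · simp only [Fin.reduceAdd, t1, t2, t3, t1', t3', u2']
      linear_combination h
    · simp [coefUp]
    · simp only [param, Matrix.cons_val]
      simp only [z4, z6]
      field_simp
    · simp only [rootUp, Matrix.cons_val]
      simp only [z6, z8]
      field_simp
  | 3 =>
    have h := R_bilinear_down hr0 hr hb' hx (isAdj_sub_one' m) (isAdj_sub_one n)
    rw [en, em] at h
    refine one_add_mul_div_eq (e := (r ^ 2) ^ n) (e' := (r ^ 2) ^ m)
      (β := r ^ 2 * (r ^ 2 * ((r ^ 2) ^ (-(m - n)) * a))⁻¹) hN hD ?_ ?_ ?_ ?_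
    · simp only [inv_mul_cancel_left₀ hr2] at h
      simp only [Fin.reduceAdd, t0, t2, t3, t0', t2', u3']
      linear_combination h
    · simp [coefUp]
    · simp only [param, Matrix.cons_val]
      simp only [z6, z11]
      field_simp
    · simp only [rootUp, Matrix.cons_val]
      simp only [z5, z6]
      field_simp

lemma stairTau_down (i : Fin 4)
    (hD : stairTau r m n a (i + 3) (r ^ 2 * x) * stairTau r m n a (i + 1) x ≠ 0) :
    1 + paramDown r m n a i * stairRatio r m n a i x =
      coefDown r m n i * (1 + rootDown r m n a i * x⁻¹) *
        (stairTau r m n a i (r ^ 2 * x) * stairNext r m n a i x /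
        (stairTau r m n a (i + 3) (r ^ 2 * x) * stairTau r m n a (i + 1) x)) := by
  obtain ⟨⟨t0, t1, t2, t3⟩, u0, u1, u2, u3⟩ := stairTau_eq m n a hr0 x
  obtain ⟨⟨t0', t1', t2', t3'⟩, u0', u1', u2', u3'⟩ := stairTau_eq m n a hr0 (r ^ 2 * x)
  have hr2 : r ^ 2 ≠ 0 := pow_ne_zero 2 hr0
  have hb : (r ^ 2) ^ (-(m - n)) * a ≠ 0 := mul_ne_zero (zpow_ne_zero _ hr2) ha
  have hb' : r ^ 2 * ((r ^ 2) ^ (-(m - n)) * a) ≠ 0 := mul_ne_zero hr2 hb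
  obtain ⟨⟨z1, z2, z3, z4⟩, ⟨z5, z6, z7, z8⟩, z9, z10, z11, z12⟩ := zpow_expand m n hr0
  obtain ⟨em, em'⟩ := zpow_weight_sub r m
  obtain ⟨en, en'⟩ := zpow_weight_sub r n
  have hM : (r ^ 2) ^ m ≠ 0 := zpow_ne_zero _ hr2
  have hN : (r ^ 2) ^ n ≠ 0 := zpow_ne_zero _ hr2
  match i with
  | 0 =>
    have h := R_bilinear_down hr0 hr hb hx (isAdj_sub_one m) (isAdj_sub_one n)
    rw [en, em'] at h
    refine one_add_mul_div_eq (e := (r ^ 2) ^ n) (e' := ((r ^ 2) ^ m)⁻¹)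
      (β := r ^ 2 * ((r ^ 2) ^ (-(m - n)) * a)⁻¹) hN hD ?_ ?_ ?_ ?_
    · simp only [Fin.reduceAdd, t1, t3, t0', t1', t3', u0]
      linear_combination h
    · simp [coefDown]
    · simp only [paramDown, Matrix.cons_val]
      simp only [z2, z6]
      field_simp
    · simp only [rootDown, Matrix.cons_val]
      simp only [z6, z7]
      field_simp
  | 1 =>
    have h := R_bilinear_up hr0 hr hb' hx (isAdj_sub_one m) (isAdj_sub_one' n)
    rw [em', en'] at h
    refine one_add_mul_div_eq (e := ((r ^ 2) ^ m)⁻¹) (e' := ((r ^ 2) ^ n)⁻¹)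
      (β := (r ^ 2) ^ (-(m - n)) * a) (inv_ne_zero hM) hD ?_ ?_ ?_ ?_
    · simp only [inv_mul_cancel_left₀ hr2] at h
      simp only [Fin.reduceAdd, t0, t2, t0', t1', t2', u1]
      linear_combination h
    · simp [coefDown]
    · simp only [paramDown, Matrix.cons_val]
      simp only [z6]
      field_simp
    · simp only [rootDown, Matrix.cons_val]
  | 2 =>
    have h := R_bilinear_down hr0 hr hb hx (isAdj_sub_one' m) (isAdj_sub_one' n)
    rw [en', em] at h
    refine one_add_mul_div_eq (e := ((r ^ 2) ^ n)⁻¹) (e' := (r ^ 2) ^ m)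
      (β := r ^ 2 * ((r ^ 2) ^ (-(m - n)) * a)⁻¹) (inv_ne_zero hN) hD ?_ ?_ ?_ ?_
    · simp only [Fin.reduceAdd, t1, t3, t1', t2', t3', u2]
      linear_combination h
    · simp [coefDown]
    · simp only [paramDown, Matrix.cons_val]
      simp only [z3, z6]
      field_simp
    · simp only [rootDown, Matrix.cons_val]
      simp only [z6, z7]
      field_simp
  | 3 =>
    have h := R_bilinear_up hr0 hr hb' hx (isAdj_sub_one' m) (isAdj_sub_one n)
    rw [em, en] at h
    refine one_add_mul_div_eq (e := (r ^ 2) ^ m) (e' := (r ^ 2) ^ n)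
      (β := (r ^ 2) ^ (-(m - n)) * a) hM hD ?_ ?_ ?_ ?_
    · simp only [inv_mul_cancel_left₀ hr2] at h
      simp only [Fin.reduceAdd, t0, t2, t0', t2', t3', u3]
      linear_combination h
    · simp [coefDown]
    · simp only [paramDown, Matrix.cons_val]
      simp only [z6, z12]
      field_simp
    · simp only [rootDown, Matrix.cons_val]

/-- This relation brings in the point qx: once D_i is put over a common denominator, its numerator
contains the left side, and the right side is a single product. -/
lemma stairTau_toda (hx2 : r ^ 2 * x ^ 2 ≠ 1) (i : Fin 4) :
    coefUp r m n i * (stairTau r m n a i (r ^ 2 * x) * stairNext r m n a i (r ^ 2 * x)) +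
      param r m n a i * param r m n a (i + 1) * coefUp r m n (i + 2) * (x ^ 2)⁻¹ *
        (stairTau r m n a (i + 2) (r ^ 2 * x) * stairNext r m n a (i + 2) (r ^ 2 * x)) =
      coefToda r m n i * (1 + (r ^ 2)⁻¹ * (x ^ 2)⁻¹) *
        (stairTau r m n a (i + 3) (r ^ 2 * (r ^ 2 * x)) * stairTau r m n a (i + 1) x) := by
  obtain ⟨⟨t0, t1, t2, t3⟩, -⟩ := stairTau_eq m n a hr0 x
  obtain ⟨⟨t0', t1', t2', t3'⟩, u0', u1', u2', u3'⟩ := stairTau_eq m n a hr0 (r ^ 2 * x)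
  obtain ⟨⟨t0'', t1'', t2'', t3''⟩, -⟩ := stairTau_eq m n a hr0 (r ^ 2 * (r ^ 2 * x))
  have hr2 : r ^ 2 ≠ 0 := pow_ne_zero 2 hr0
  have hb : (r ^ 2) ^ (-(m - n)) * a ≠ 0 := mul_ne_zero (zpow_ne_zero _ hr2) ha
  have hb' : r ^ 2 * ((r ^ 2) ^ (-(m - n)) * a) ≠ 0 := mul_ne_zero hr2 hb
  obtain ⟨⟨z1, z2, z3, z4⟩, ⟨z5, z6, z7, z8⟩, z9, z10, z11, z12⟩ := zpow_expand m n hr0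
  obtain ⟨em, em'⟩ := zpow_weight_sub r m
  obtain ⟨en, en'⟩ := zpow_weight_sub r n
  have hM : (r ^ 2) ^ m ≠ 0 := zpow_ne_zero _ hr2
  have hN : (r ^ 2) ^ n ≠ 0 := zpow_ne_zero _ hr2
  match i with
  | 0 =>
    have h := R_bilinear_up_down hr0 hr hb hx (isAdj_sub_one m) (isAdj_sub_one n) hx2
    rw [em', en] at h
    refine add_eq_of_scaled (e := ((r ^ 2) ^ m)⁻¹ * (r ^ 2) ^ n) ?_ ?_ ?_
    · simp only [Fin.reduceAdd, t1, t0', t2', u0', u2', t3'']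
      linear_combination h
    · simp only [coefUp, coefToda, Matrix.cons_val, z9, z10]
      field_simp
    · simp only [coefUp, param, Fin.reduceAdd, Matrix.cons_val, z1, z4, z9, z10, z11]
      field_simp
  | 1 =>
    have h := R_bilinear_up_down hr0 hr hb' hx (isAdj_sub_one m) (isAdj_sub_one' n) hx2
    rw [em', en'] at h
    simp only [inv_mul_cancel_left₀ hr2] at h
    refine add_eq_of_scaled (e := ((r ^ 2) ^ m)⁻¹ * ((r ^ 2) ^ n)⁻¹) ?_ ?_ ?_
    · simp only [Fin.reduceAdd, t2, t1', t3', u1', u3', t0'']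
      linear_combination h
    · simp only [coefUp, coefToda, Matrix.cons_val, z9, z10]
      field_simp
    · simp only [coefUp, param, Fin.reduceAdd, Matrix.cons_val, z1, z4, z9, z10, z11]
      field_simp
  | 2 =>
    have h := R_bilinear_up_down hr0 hr hb hx (isAdj_sub_one' m) (isAdj_sub_one' n) hx2
    rw [em, en'] at h
    refine add_eq_of_scaled (e := (r ^ 2) ^ m * ((r ^ 2) ^ n)⁻¹) ?_ ?_ ?_
    · simp only [Fin.reduceAdd, t3, t0', t2', u0', u2', t1'']
      linear_combination h
    · simp only [coefUp, coefToda, Matrix.cons_val, z9, z10]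
      field_simp
    · simp only [coefUp, param, Fin.reduceAdd, Matrix.cons_val, z1, z4, z9, z10, z11]
      field_simp
  | 3 =>
    have h := R_bilinear_up_down hr0 hr hb' hx (isAdj_sub_one' m) (isAdj_sub_one n) hx2
    rw [em, en] at h
    simp only [inv_mul_cancel_left₀ hr2] at h
    refine add_eq_of_scaled (e := (r ^ 2) ^ m * (r ^ 2) ^ n) ?_ ?_ ?_
    · simp only [Fin.reduceAdd, t0, t1', t3', u1', u3', t2'']
      linear_combination h
    · simp only [coefUp, coefToda, Matrix.cons_val, z9, z10]
      field_simp
    · simp only [coefUp, param, Fin.reduceAdd, Matrix.cons_val, z1, z4, z9, z10, z11]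
      field_simp

lemma evolDen_stairRatio (hx2 : r ^ 2 * x ^ 2 ≠ 1) (i : Fin 4)
    (hT : ∀ j, stairTau r m n a j x ≠ 0) (hT' : ∀ j, stairTau r m n a j (r ^ 2 * x) ≠ 0) :
    evolDen (param r m n a) (fun j => stairRatio r m n a j x) i =
      coefToda r m n i * (1 + (r ^ 2)⁻¹ * (x ^ 2)⁻¹) * (1 + rootUp r m n a i * x⁻¹) *
        (stairTau r m n a i x * stairTau r m n a (i + 3) (r ^ 2 * (r ^ 2 * x)) /
        (stairTau r m n a i (r ^ 2 * x) * stairTau r m n a (i + 3) (r ^ 2 * x))) := by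
  have h1 := stairTau_up hr0 hr m n ha hx i (mul_ne_zero (hT' _) (hT _))
  have h2 := stairTau_up hr0 hr m n ha hx (i + 2) (mul_ne_zero (hT' _) (hT _))
  have h3 := stairTau_toda hr0 hr m n ha hx hx2 i
  have hroot : rootUp r m n a (i + 2) = rootUp r m n a i := by
    fin_cases i <;> rfl
  rw [hroot] at h2
  -- The last two terms of D_i share the factor 1 + a_{i+2} f_{i+2}, so `stairTau_up` applies twice.
  have h4 : evolDen (param r m n a) (fun j => stairRatio r m n a j x) i =
      (1 + param r m n a i * stairRatio r m n a i x) +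
      param r m n a i * param r m n a (i + 1) *
        (stairRatio r m n a i x * stairRatio r m n a (i + 1) x) *
        (1 + param r m n a (i + 2) * stairRatio r m n a (i + 2) x) := by
    rw [evolDen]
    ring
  rw [h4, h1, h2]
  simp only [stairRatio, add_assoc i, Fin.reduceAdd, add_zero]
  have H0 := hT i
  have H1 := hT (i + 1)
  have H2 := hT (i + 2)
  have H3 := hT (i + 3)
  have H0' := hT' i
  have H1' := hT' (i + 1)
  have H2' := hT' (i + 2)
  have H3' := hT' (i + 3)
  generalize 1 + rootUp r m n a i * x⁻¹ = ρ
  trans ρ * stairTau r m n a i x / (stairTau r m n a (i + 3) (r ^ 2 * x) *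
      stairTau r m n a (i + 1) x * stairTau r m n a i (r ^ 2 * x)) *
    (coefToda r m n i * (1 + (r ^ 2)⁻¹ * (x ^ 2)⁻¹) *
        (stairTau r m n a (i + 3) (r ^ 2 * (r ^ 2 * x)) * stairTau r m n a (i + 1) x))
  · rw [← h3]
    field_simp
  · generalize 1 + (r ^ 2)⁻¹ * (x ^ 2)⁻¹ = σ
    field_simp

/-- In D_{i+2}/D_i the linear factors cancel, since `rootUp` has period 2 in i, and so does 1 +
q^{-1/2}x⁻². The constants leave q^{-1/2}, which is the factor produced by x⁻¹ under x → q^{1/2}x.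
-/
lemma stairRatio_dilate (hx2 : r ^ 2 * x ^ 2 ≠ 1) (i : Fin 4)
    (hT : ∀ j, stairTau r m n a j x ≠ 0) (hT' : ∀ j, stairTau r m n a j (r ^ 2 * x) ≠ 0)
    (hT'' : ∀ j, stairTau r m n a j (r ^ 2 * (r ^ 2 * x)) ≠ 0)
    (hσ : 1 + (r ^ 2)⁻¹ * (x ^ 2)⁻¹ ≠ 0) (hρ : 1 + rootUp r m n a i * x⁻¹ ≠ 0) :
    evolDen (param r m n a) (fun j => stairRatio r m n a j x) i ≠ 0 ∧
    stairRatio r m n a i (r ^ 2 * x) =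
      param r m n a i * param r m n a (i + 1) * stairRatio r m n a (i + 1) x *
        (evolDen (param r m n a) (fun j => stairRatio r m n a j x) (i + 2) /
          evolDen (param r m n a) (fun j => stairRatio r m n a j x) i) := by
  have hr2 : r ^ 2 ≠ 0 := pow_ne_zero 2 hr0
  have hroot : rootUp r m n a (i + 2) = rootUp r m n a i := by
    fin_cases i <;> rfl
  have hδ : coefToda r m n i ≠ 0 := by
    fin_cases i <;> exact zpow_ne_zero _ hr2
  have hcoef : param r m n a i * param r m n a (i + 1) * coefToda r m n (i + 2) =
      (r ^ 2)⁻¹ * coefToda r m n i := by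
    obtain ⟨⟨z1, z2, z3, z4⟩, ⟨z5, z6, z7, z8⟩, z9, z10, z11, z12⟩ := zpow_expand m n hr0
    have hM : (r ^ 2) ^ m ≠ 0 := zpow_ne_zero _ hr2
    have hN : (r ^ 2) ^ n ≠ 0 := zpow_ne_zero _ hr2
    match i with
    | 0 | 1 | 2 | 3 =>
      simp only [coefToda, param, Fin.reduceAdd, Matrix.cons_val, z1, z4, z9, z10, z11]
      field_simp
  have H0 := hT i
  have H2 := hT (i + 2)
  have H0' := hT' i
  have H1' := hT' (i + 1)
  have H2' := hT' (i + 2)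
  have H3' := hT' (i + 3)
  have H1'' := hT'' (i + 1)
  have H3'' := hT'' (i + 3)
  rw [evolDen_stairRatio hr0 hr m n ha hx hx2 i hT hT',
    evolDen_stairRatio hr0 hr m n ha hx hx2 (i + 2) hT hT', hroot]
  simp only [stairRatio, add_assoc i, Fin.reduceAdd, add_zero]
  refine ⟨by positivity, ?_⟩
  generalize 1 + rootUp r m n a i * x⁻¹ = ρ at *
  generalize 1 + (r ^ 2)⁻¹ * (x ^ 2)⁻¹ = σ at *
  trans (param r m n a i * param r m n a (i + 1) * coefToda r m n (i + 2)) *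
    (coefToda r m n i)⁻¹ * (x⁻¹ * (stairTau r m n a (i + 1) (r ^ 2 * (r ^ 2 * x)) *
      stairTau r m n a (i + 3) (r ^ 2 * x) /
      (stairTau r m n a (i + 3) (r ^ 2 * (r ^ 2 * x)) * stairTau r m n a (i + 1) (r ^ 2 * x))))
  · rw [hcoef]
    field_simp
  · generalize r ^ 2 * (r ^ 2 * x) = x₂ at H1'' H3'' ⊢
    generalize r ^ 2 * x = x₁ at H0' H1' H2' H3' ⊢
    field_simp

end Formulas

end QPainleveV
end

namespace QPainleveV

open Filter

/-! ### The solution as a family of rational functions -/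

section Solution

variable {r : ℂ} (hr0 : r ≠ 0) (hr : ‖r ^ 4‖ < 1) (m n : ℤ) {a : ℂ} (ha : a ≠ 0)
include hr

lemma stairTau_mem_laurent (i : Fin 4) : stairTau r m n a i ∈ laurent := by
  fin_cases i <;> exact R_mem_laurent hr _ _ _

include hr0

lemma finite_zeros_S (a : ℂ) (k l : ℤ) : {x : ℂ | x ≠ 0 ∧ S r k l x a = 0}.Finite :=
  finite_zeros_R hr0 hr _ k l

lemma eventually_stairTau_ne_zero :
    ∀ᶠ x in cofinite, ∀ i, stairTau r m n a i x ≠ 0 := by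
  have key : ∀ a' k l, ∀ᶠ x in cofinite, S r k l x a' ≠ 0 := by
    intro a' k l
    rw [eventually_cofinite]
    refine ((finite_zeros_S hr0 hr a' k l).union (Set.finite_singleton 0)).subset fun x hx => ?_
    rcases eq_or_ne x 0 with h | h
    · exact Or.inr h
    · exact Or.inl ⟨h, not_not.1 hx⟩
  rw [eventually_all]
  intro i
  fin_cases i <;> exact key _ _ _

/-- The values agree wherever the denominator is nonzero and not merely off some finite set, as the
eight pointwise formulas demand. -/
lemma exists_ratFunc_stairRatio (i : Fin 4) :
    ∃ f : RatFunc ℂ, ∀ x ≠ 0,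
      stairTau r m n a (i + 3) (r ^ 2 * x) * stairTau r m n a (i + 1) x ≠ 0 →
      f.eval (RingHom.id ℂ) x = stairRatio r m n a i x := by
  have hr2 : r ^ 2 ≠ 0 := pow_ne_zero 2 hr0
  have hT := stairTau_mem_laurent (a := a) hr m n
  obtain ⟨f, hf⟩ := exists_ratFunc
    (laurent.mul_mem inv_mem_laurent
      (laurent.mul_mem (comp_mul_mem_laurent (hT (i + 1)) hr2) (hT (i + 3))))
    (laurent.mul_mem (comp_mul_mem_laurent (hT (i + 3)) hr2) (hT (i + 1)))
  refine ⟨f, fun x hx hx' => (hf x hx hx').trans ?_⟩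
  simp only [stairRatio, Pi.mul_apply, mul_div_assoc]

include ha

lemma isSolution_of_represents {f : Fin 4 → RatFunc ℂ}
    (hf : ∀ i, Represents (f i) (stairRatio r m n a i)) :
    IsSolution (dilate (r ^ 2)) (RatFunc.C (r ^ 4)) (RatFunc.X ^ 2)
      (fun i => RatFunc.C (param r m n a i)) f := by
  have hr2 : r ^ 2 ≠ 0 := pow_ne_zero 2 hr0
  have hev : ∀ {p : ℂ → Prop}, (∀ᶠ x in cofinite, p x) → ∀ᶠ x in cofinite, p (r ^ 2 * x) :=
    fun hp => (mul_right_injective₀ hr2).tendsto_cofinite.eventually hp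
  have hT := eventually_stairTau_ne_zero (a := a) hr0 hr m n
  have h0 : ∀ᶠ x : ℂ in cofinite, x ≠ 0 := eventually_cofinite_ne 0
  have hsq : ∀ c : ℂ, ∀ᶠ x : ℂ in cofinite, r ^ 2 * x ^ 2 ≠ c := by
    intro c
    have hP : (Polynomial.C (r ^ 2) * Polynomial.X ^ 2 - Polynomial.C c) ≠ 0 := by
      intro h
      have := congrArg (fun P => Polynomial.coeff P 2) h
      rw [Polynomial.coeff_sub, Polynomial.coeff_C_mul_X_pow] at this
      simp [hr0] at this
    filter_upwards [eventually_eval_ne_zero hP] with x hx h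
    simp [h] at hx
  have key : ∀ i, ∀ᶠ x in cofinite,
      evolDen (param r m n a) (fun j => stairRatio r m n a j x) i ≠ 0 ∧
      stairRatio r m n a i (r ^ 2 * x) =
      param r m n a i * param r m n a (i + 1) * stairRatio r m n a (i + 1) x *
        (evolDen (param r m n a) (fun j => stairRatio r m n a j x) (i + 2) /
          evolDen (param r m n a) (fun j => stairRatio r m n a j x) i) := by
    intro i
    -- Excluded are the zeros of the tau functions at x, q^{1/2}x and qx, the points where the two
    -- nodes coincide (q^{1/2}x² = 1), and the zeros of the two scalar factors of D_i.
    filter_upwards [hT, hev hT, hev (hev hT), h0, hsq 1, hsq (-1),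
      eventually_cofinite_ne (-rootUp r m n a i)] with x h1 h2 h3 h4 h5 h6 h7
    refine stairRatio_dilate hr0 hr m n ha h4 h5 i h1 h2 h3 ?_ ?_
    · contrapose! h6
      field_simp at h6
      linear_combination h6
    · contrapose! h7
      field_simp at h7
      linear_combination h7
  have hX2 : Represents (RatFunc.X ^ 2) (fun x => x * x) := by
    simpa only [sq] using represents_X.mul represents_X
  -- Passing from i to i + 2 exchanges the indices i + 1 and i + 3, so the tau quotients of f_i and
  -- f_{i+2} are inverse to each other.
  have hnorm : ∀ i, f i * f (i + 2) = (RatFunc.X ^ 2)⁻¹ := by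
    intro i
    refine ((hf i).mul (hf (i + 2))).ext hX2.inv ?_
    filter_upwards [hT, hev hT] with x h1 h2
    simp only [stairRatio, add_assoc i, Fin.reduceAdd]
    have H1 := h1 (i + 1)
    have H3 := h1 (i + 3)
    have H1' := h2 (i + 1)
    have H3' := h2 (i + 3)
    generalize r ^ 2 * x = x₁ at *
    field_simp
  have hden : ∀ i, Represents (evolDen (fun i => RatFunc.C (param r m n a i)) f i)
      (fun x => evolDen (param r m n a) (fun j => stairRatio r m n a j x) i) :=
    fun i => Represents.evolDen (fun _ => rfl) hf i
  refine ⟨fun i => dilate_C _ _, ?_, ?_, hnorm 0, hnorm 1, fun i => (hden i).ne_zero ?_,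
    fun i => ?_⟩
  · refine (hX2.dilate hr2).ext ((represents_C _).mul hX2) (.of_forall fun x => ?_)
    ring
  · obtain ⟨⟨z1, z2, z3, z4⟩, -, z9, z10, z11, z12⟩ := zpow_expand m n hr0
    have hM : (r ^ 2) ^ m ≠ 0 := zpow_ne_zero _ hr2
    have hN : (r ^ 2) ^ n ≠ 0 := zpow_ne_zero _ hr2
    rw [← map_mul, ← map_mul, ← map_mul, ← map_inv₀]
    congr 1
    simp only [param, Matrix.cons_val, z1, z4, z11]
    field_simp
  · filter_upwards [key i] with x h using h.1
  · refine ((hf i).dilate hr2).ext ((((represents_C _).mul (represents_C _)).mul (hf _)).mul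
      ((hden (i + 2)).div (hden i))) ?_
    filter_upwards [key i] with x h using h.2

end Solution

end QPainleveV

theorem theorem1 (q r : ℂ) (hq0 : q ≠ 0) (hq1 : ‖q‖ < 1) (hr : r ^ 4 = q)
    (m n : ℤ) (a : ℂ) (ha : a ≠ 0) :
    -- no `S_{k,l}(·, a')` vanishes identically, so that the ratios below make sense
    (∀ (k l : ℤ) (a' : ℂ), a' ≠ 0 →
      {x : ℂ | x ≠ 0 ∧ QPainleveV.S r k l x a' = 0}.Finite) ∧
    ∃ f : Fin 4 → RatFunc ℂ,
      (∀ x : ℂ, x ≠ 0 →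
        (QPainleveV.S r m (n - 1) (r ^ 2 * x) a ≠ 0 →
          QPainleveV.S r (m - 1) n x (q⁻¹ * a) ≠ 0 →
          1 + (r ^ 2) ^ (2 * n - 1) * a * (f 0).eval (RingHom.id ℂ) x =
              (r ^ 2) ^ m * (1 + (r ^ 2) ^ (-(m - n + 1)) * a * x⁻¹) *
                ((QPainleveV.S r m n x a *
                    QPainleveV.S r (m - 1) (n - 1) (r ^ 2 * x) (q⁻¹ * a)) /
                  (QPainleveV.S r m (n - 1) (r ^ 2 * x) a *
                    QPainleveV.S r (m - 1) n x (q⁻¹ * a))) ∧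
          1 + (r ^ 2) ^ (-(2 * n - 1)) * a⁻¹ * (f 0).eval (RingHom.id ℂ) x =
              (r ^ 2) ^ (-n) * (1 + (r ^ 2) ^ (m - n + 1) * a⁻¹ * x⁻¹) *
                ((QPainleveV.S r m n (r ^ 2 * x) a *
                    QPainleveV.S r (m - 1) (n - 1) x (q⁻¹ * a)) /
                  (QPainleveV.S r m (n - 1) (r ^ 2 * x) a *
                    QPainleveV.S r (m - 1) n x (q⁻¹ * a)))) ∧
        (QPainleveV.S r m n (r ^ 2 * x) a ≠ 0 →
          QPainleveV.S r (m - 1) (n - 1) x a ≠ 0 →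
          1 + a⁻¹ * (f 1).eval (RingHom.id ℂ) x =
              (r ^ 2) ^ n * (1 + (r ^ 2) ^ (m - n) * a⁻¹ * x⁻¹) *
                ((QPainleveV.S r (m - 1) n x (q⁻¹ * a) *
                    QPainleveV.S r m (n - 1) (r ^ 2 * x) (q * a)) /
                  (QPainleveV.S r m n (r ^ 2 * x) a *
                    QPainleveV.S r (m - 1) (n - 1) x a)) ∧
          1 + a * (f 1).eval (RingHom.id ℂ) x =
              (r ^ 2) ^ m * (1 + (r ^ 2) ^ (-(m - n)) * a * x⁻¹) *
                ((QPainleveV.S r (m - 1) n (r ^ 2 * x) (q⁻¹ * a) *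
                    QPainleveV.S r m (n - 1) x (q * a)) /
                  (QPainleveV.S r m n (r ^ 2 * x) a *
                    QPainleveV.S r (m - 1) (n - 1) x a))) ∧
        (QPainleveV.S r (m - 1) n (r ^ 2 * x) (q⁻¹ * a) ≠ 0 →
          QPainleveV.S r m (n - 1) x a ≠ 0 →
          1 + (r ^ 2) ^ (-(2 * m + 1)) * a * (f 2).eval (RingHom.id ℂ) x =
              (r ^ 2) ^ (-m) * (1 + (r ^ 2) ^ (-(m - n + 1)) * a * x⁻¹) *
                ((QPainleveV.S r (m - 1) (n - 1) x a *
                    QPainleveV.S r m n (r ^ 2 * x) (q⁻¹ * a)) /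
                  (QPainleveV.S r (m - 1) n (r ^ 2 * x) (q⁻¹ * a) *
                    QPainleveV.S r m (n - 1) x a)) ∧
          1 + (r ^ 2) ^ (2 * m + 1) * a⁻¹ * (f 2).eval (RingHom.id ℂ) x =
              (r ^ 2) ^ n * (1 + (r ^ 2) ^ (m - n + 1) * a⁻¹ * x⁻¹) *
                ((QPainleveV.S r (m - 1) (n - 1) (r ^ 2 * x) a *
                    QPainleveV.S r m n x (q⁻¹ * a)) /
                  (QPainleveV.S r (m - 1) n (r ^ 2 * x) (q⁻¹ * a) *
                    QPainleveV.S r m (n - 1) x a))) ∧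
        (QPainleveV.S r (m - 1) (n - 1) (r ^ 2 * x) a ≠ 0 →
          QPainleveV.S r m n x a ≠ 0 →
          1 + q ^ (m - n) * a⁻¹ * (f 3).eval (RingHom.id ℂ) x =
              (r ^ 2) ^ (-n) * (1 + (r ^ 2) ^ (m - n) * a⁻¹ * x⁻¹) *
                ((QPainleveV.S r m (n - 1) x a *
                    QPainleveV.S r (m - 1) n (r ^ 2 * x) a) /
                  (QPainleveV.S r (m - 1) (n - 1) (r ^ 2 * x) a *
                    QPainleveV.S r m n x a)) ∧
          1 + q ^ (-m + n) * a * (f 3).eval (RingHom.id ℂ) x =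
              (r ^ 2) ^ (-m) * (1 + (r ^ 2) ^ (-(m - n)) * a * x⁻¹) *
                ((QPainleveV.S r m (n - 1) (r ^ 2 * x) a *
                    QPainleveV.S r (m - 1) n x a) /
                  (QPainleveV.S r (m - 1) (n - 1) (r ^ 2 * x) a *
                    QPainleveV.S r m n x a)))) ∧
      QPainleveV.IsSolution (QPainleveV.dilate (r ^ 2)) (RatFunc.C q) (RatFunc.X ^ 2)
        ![RatFunc.C ((r ^ 2) ^ (2 * n - 1) * a), RatFunc.C a⁻¹,
          RatFunc.C ((r ^ 2) ^ (-(2 * m + 1)) * a), RatFunc.C (q ^ (m - n) * a⁻¹)]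
        f := by
  subst hr
  have hr0 : r ≠ 0 := by
    rintro rfl
    simp at hq0
  refine ⟨fun k l a' _ => QPainleveV.finite_zeros_S hr0 hq1 a' k l, ?_⟩
  choose f hf using QPainleveV.exists_ratFunc_stairRatio (a := a) hr0 hq1 m n
  refine ⟨f, fun x hx => ⟨fun h1 h2 => ?_, fun h1 h2 => ?_, fun h1 h2 => ?_, fun h1 h2 => ?_⟩, ?_⟩
  · rw [hf 0 x hx (mul_ne_zero h1 h2)]
    exact ⟨QPainleveV.stairTau_up hr0 hq1 m n ha hx 0 (mul_ne_zero h1 h2),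
      QPainleveV.stairTau_down hr0 hq1 m n ha hx 0 (mul_ne_zero h1 h2)⟩
  · rw [hf 1 x hx (mul_ne_zero h1 h2)]
    exact ⟨QPainleveV.stairTau_up hr0 hq1 m n ha hx 1 (mul_ne_zero h1 h2),
      QPainleveV.stairTau_down hr0 hq1 m n ha hx 1 (mul_ne_zero h1 h2)⟩
  · rw [hf 2 x hx (mul_ne_zero h1 h2)]
    exact ⟨QPainleveV.stairTau_up hr0 hq1 m n ha hx 2 (mul_ne_zero h1 h2),
      QPainleveV.stairTau_down hr0 hq1 m n ha hx 2 (mul_ne_zero h1 h2)⟩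
  · rw [hf 3 x hx (mul_ne_zero h1 h2)]
    exact ⟨QPainleveV.stairTau_up hr0 hq1 m n ha hx 3 (mul_ne_zero h1 h2),
      QPainleveV.stairTau_down hr0 hq1 m n ha hx 3 (mul_ne_zero h1 h2)⟩
  · convert QPainleveV.isSolution_of_represents hr0 hq1 m n ha (f := f) fun i => ?_ using 1
    · funext i
      fin_cases i <;> rfl
    · filter_upwards [QPainleveV.eventually_stairTau_ne_zero (a := a) hr0 hq1 m n,
        (mul_right_injective₀ (pow_ne_zero 2 hr0)).tendsto_cofinite.eventually
          (QPainleveV.eventually_stairTau_ne_zero (a := a) hr0 hq1 m n),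
        Filter.eventually_cofinite_ne 0] with x h1 h2 h3
      exact hf i x h3 (mul_ne_zero (h2 _) (h1 _))
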